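/- Let $\{(X_n,Y_n), n\ge 1\}$ be iid bivariate random vectors (claim sizes) with distribution function $F$, and let $N(t)$, $t\ge 0$, be random variables with values in $\{0,1,2,\dots\}$ (the number of claims up to time $t$) such that, for each $t\ge0$, the sequence $\{(X_n,Y_n)\}$ is independent of $N(t)$. For $1\le k\le n$ write $X_{k:n}$ and $Y_{k:n}$ for the $k$-th smallest of $X_1,\dots,X_n$ and of $Y_1,\dots,Y_n$, respectively (each component is ordered separately); for $k\notin\{1,\dots,n\}$ set $X_{k:n}=Y_{k:n}=0$, and on $\{N(t)<j\}$ read $X_{N(t)-j+1:N(t)}=Y_{N(t)-j+1:N(t)}=0$. Let $H$ be a bivariate distribution function each of whose marginals $H_1,H_2$ is one of the standard extreme value distribution functions $$\Phi_\alpha(x)=e^{-x^{-\alpha}}\mathbf 1_{\{x>0\}},\qquad \Psi_\alpha(x)=e^{-|x|^{\alpha}}\ (x<0),\ \ \Psi_\alpha(x)=1\ (x\ge 0),\qquad \Lambda(x)=e^{-e^{-x}},\qquad \alpha>0 .$$ Suppose that $F\in MDA(H)$: there are real functions $a_i,b_i$, $i=1,2$, with $a_i(t)>0$ for all large $t$,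 such that $$\lim_{t\to\infty}\ \sup_{(x,y)\in\mathbb R^2}\bigl|F^t(a_1(t)x+b_1(t),\,a_2(t)y+b_2(t))-H(x,y)\bigr|=0 .$$ Suppose further that $N(t)/t\to\mathcal Z$ in distribution as $t\to\infty$, where $\mathcal Z>0$ almost surely. For $i=1,2$ put $\gamma_i=1/\alpha_i,\ \delta_i=0$ if $H_i=\Phi_{\alpha_i}$; $\gamma_i=-1/\alpha_i,\ \delta_i=0$ if $H_i=\Psi_{\alpha_i}$; $\gamma_i=0,\ \delta_i=\ln\mathcal Z$ if $H_i=\Lambda$. Then for every integer $m\ge1$ there are random vectors $(\mathcal X_1,\mathcal Y_1),\dots,(\mathcal X_m,\mathcal Y_m)$, jointly independent of $\mathcal Z$, such that $(\mathcal X_1,\mathcal Y_1)$ has distribution function $H$, such that $$\Bigl(\tfrac{X_{n-j+1:n}-b_1(n)}{a_1(n)},\tfrac{Y_{n-j+1:n}-b_2(n)}{a_2(n)}\Bigr)_{j=1,\dots,m}\ \xrightarrow{d}\ \bigl(\mathcal X_j,\mathcal Y_j\bigr)_{j=1,\dots,m},\qquad n\to\infty,$$ (so their joint law is uniquely determined),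 and such that $$\Bigl(\tfrac{X_{N(t)-j+1:N(t)}-b_1(t)}{a_1(t)},\tfrac{Y_{N(t)-j+1:N(t)}-b_2(t)}{a_2(t)}\Bigr)_{j=1,\dots,m}\ \xrightarrow{d}\ \bigl(\mathcal Z^{\gamma_1}\mathcal X_j+\delta_1,\ \mathcal Z^{\gamma_2}\mathcal Y_j+\delta_2\bigr)_{j=1,\dots,m},\qquad t\to\infty .$$ -/

import Mathlib

open MeasureTheory ProbabilityTheory Filter Topology Set
open scoped NNReal

noncomputable section

/-- The `k`-th smallest value `x_{k:n}`, `1 ≤ k ≤ n`, among the first `n` terms `x 0, …, x (n - 1)`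
of a real sequence (values counted with multiplicity); thus `x_{n:n}` is the largest value.
The value is `0` when `k` is not in `{1, …, n}`. -/
def orderStat (x : ℕ → ℝ) (n k : ℕ) : ℝ :=
  if h : 1 ≤ k ∧ k ≤ n then
    x (Tuple.sort (fun i : Fin n => x i) ⟨k - 1, by omega⟩)
  else 0

/-- The upper `m` order statistics of `x` and of `y`, each sequence being ordered separately,
among the first `n` terms, normalized with `a₁ s, b₁ s` and `a₂ s, b₂ s`: the entry with index
`j = 0, …, m - 1` is
`((x_{n-j:n} - b₁ s) / a₁ s, (y_{n-j:n} - b₂ s) / a₂ s)`. -/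
def normUpperStats (a₁ b₁ a₂ b₂ : ℝ → ℝ) (m : ℕ) (s : ℝ) (n : ℕ) (x y : ℕ → ℝ) :
    Fin m → ℝ × ℝ :=
  fun j => ((orderStat x n (n - j) - b₁ s) / a₁ s, (orderStat y n (n - j) - b₂ s) / a₂ s)

/-- The three families of standard univariate extreme value distributions. -/
inductive ExtremeType : Type
  /-- unit Fréchet `Φ_α` -/
  | frechet (α : ℝ) (hα : 0 < α) : ExtremeType
  /-- unit Weibull `Ψ_α` -/
  | weibull (α : ℝ) (hα : 0 < α) : ExtremeType
  /-- unit Gumbel `Λ` -/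
  | gumbel : ExtremeType

namespace ExtremeType

/-- The distribution function of a standard extreme value distribution. -/
def distFun : ExtremeType → ℝ → ℝ
  | frechet α _, x => if 0 < x then Real.exp (-x ^ (-α)) else 0
  | weibull α _, x => if x < 0 then Real.exp (-|x| ^ α) else 1
  | gumbel, x => Real.exp (-Real.exp (-x))

/-- The exponent `γ`: `1 / α` for `Φ_α`, `-1 / α` for `Ψ_α`, and `0` for `Λ`. -/
def gamma : ExtremeType → ℝ
  | frechet α _ => 1 / α
  | weibull α _ => -1 / α
  | gumbel => 0

/-- The shift `δ` as a function of `z > 0`: `ln z` for `Λ`, and `0` for `Φ_α` and `Ψ_α`. -/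
def delta : ExtremeType → ℝ → ℝ
  | frechet _ _, _ => 0
  | weibull _ _, _ => 0
  | gumbel, z => Real.log z

end ExtremeType

/-- The distribution function `(x, y) ↦ μ ((-∞, x] × (-∞, y])` of a measure on the plane. -/
def bivDistFun (μ : Measure (ℝ × ℝ)) (x y : ℝ) : ℝ := μ.real (Iic x ×ˢ Iic y)

/-- `F ∈ MDA(H)` with norming functions `a₁, b₁, a₂, b₂`: the functions `a₁, a₂` are positive
for large arguments and `F^t (a₁(t) x + b₁(t), a₂(t) y + b₂(t))` converges to `H(x, y)` as
`t → ∞`, uniformly in `(x, y) ∈ ℝ²`. The measures `F` and `H` are identified with their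
distribution functions. -/
def InMDA (F H : Measure (ℝ × ℝ)) (a₁ b₁ a₂ b₂ : ℝ → ℝ) : Prop :=
  (∀ᶠ t in atTop, 0 < a₁ t) ∧ (∀ᶠ t in atTop, 0 < a₂ t) ∧
  TendstoUniformly
    (fun (t : ℝ) (p : ℝ × ℝ) =>
      bivDistFun F (a₁ t * p.1 + b₁ t) (a₂ t * p.2 + b₂ t) ^ t)
    (fun p : ℝ × ℝ => bivDistFun H p.1 p.2) atTop

end

/-! The `(j + 1)`-st largest of `n` values is at most `u` iff at most `j` of them exceed `u`. Joint
distribution functions of the upper order statistics are therefore probabilities about the numbers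
of points of an iid sample in half-planes that move off to the upper end of the distribution.

Fixed index. The joint generating function of the counts is an `n`-th power whose base differs from
`1` by a combination of measures of unions of half-planes. Such a union is the complement of a
quadrant, or is a half-plane, so `n` times its measure tends to `-log H` at a corner, or to `-log`
of a marginal, and the generating functions converge (`exists_tendsto_measure_countUpTo_le`). If a
marginal of `H` vanishes at some threshold, a block argument makes the limit `0` instead. So all
joint distribution functions converge; with tightness (`isTightMeasureSet_normUpperStats`) and
Prokhorov's theorem this gives a weak limit `ν`, which never has to be written explicitly. The law
of the pair of maxima is `F ^ n`, so the first marginal of `ν` is `H`.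

Random index. If `n / t → z > 0`, max-stability and convergence of types (`tendsto_norming_ratio`)
show that passing from the norming at `n` to the norming at `t` acts in the limit as the affine map
with slopes `z ^ γᵢ` and shifts `δᵢ`. By independence, the expectation of a bounded continuous
function of the randomly indexed vector is the integral of a function `h_t` against the law of `N(t)
/ t`. These functions converge continuously on `(0, ∞)`, which carries the law of `𝒵`, so the
extended continuous mapping theorem (`tendsto_integral_of_continuousConvergence`) gives the limit.
Fubini's theorem identifies it as an expectation under the product law, where `𝒵` and the limit
vector are independent. -/

/-! ### Order statistics and exceedance counts -/

/-- The number of terms among the first `n` lying in `A`. -/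
noncomputable def countUpTo {S : Type*} (A : Set S) (w : ℕ → S) (n : ℕ) : ℕ :=
  open Classical in ((Finset.range n).filter fun i => w i ∈ A).card

/-- Sorting permutes the indices, so exceedances may be counted along the sorted sequence, where
they form a final segment. -/
theorem countUpTo_Ioi_eq (x : ℕ → ℝ) (n : ℕ) (u : ℝ) :
    countUpTo (Ioi u) x n
      = (Finset.univ.filter fun i : Fin n => u < x (Tuple.sort (fun i : Fin n => x i) i)).card := by
  classical
  rw [countUpTo]
  symm
  refine Finset.card_bij (fun i _ => ((Tuple.sort (fun i : Fin n => x i) i : Fin n) : ℕ)) ?_ ?_ ?_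
  · intro i hi
    simpa using hi
  · intro i _ j _ h
    exact (Tuple.sort (fun i : Fin n => x i)).injective (Fin.ext h)
  · intro b hb
    simp only [Finset.mem_filter, Finset.mem_range, mem_Ioi] at hb
    refine ⟨(Tuple.sort (fun i : Fin n => x i)).symm ⟨b, hb.1⟩, ?_, ?_⟩
    · simpa using hb.2
    · simp

/-- The `(j + 1)`-st largest value is at most `u` iff at most `j` terms exceed `u`. -/
theorem orderStat_le_iff (x : ℕ → ℝ) {n j : ℕ} (hj : j < n) (u : ℝ) :
    orderStat x n (n - j) ≤ u ↔ countUpTo (Ioi u) x n ≤ j := by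
  have hk : 1 ≤ n - j ∧ n - j ≤ n := by omega
  rw [orderStat, dif_pos hk, countUpTo_Ioi_eq]
  have hmono : Monotone fun i : Fin n => x (Tuple.sort (fun i : Fin n => x i) i) :=
    Tuple.monotone_sort (fun i : Fin n => x i)
  -- The zero-based position of the `(j + 1)`-st largest value: exactly `j` positions lie strictly
  -- above it.
  set p : Fin n := ⟨n - j - 1, by omega⟩ with hp
  constructor
  · intro h
    have hsub : (Finset.univ.filter fun i : Fin n =>
        u < x (Tuple.sort (fun i : Fin n => x i) i)) ⊆ Finset.Ioi p := by
      intro i hi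
      simp only [Finset.mem_filter, Finset.mem_univ, true_and] at hi
      rw [Finset.mem_Ioi]
      by_contra hle
      exact absurd (hmono (not_lt.mp hle)) (not_le.mpr (h.trans_lt hi))
    refine (Finset.card_le_card hsub).trans ?_
    rw [Fin.card_Ioi, hp]
    simp only
    omega
  · intro h
    by_contra hlt
    have hsub : Finset.Ici p ⊆ (Finset.univ.filter fun i : Fin n =>
        u < x (Tuple.sort (fun i : Fin n => x i) i)) := by
      intro i hi
      simp only [Finset.mem_filter, Finset.mem_univ, true_and]
      exact (not_le.mp hlt).trans_le (hmono (Finset.mem_Ici.mp hi))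
    have := (Finset.card_le_card hsub).trans h
    rw [Fin.card_Ici, hp] at this
    simp only at this
    omega

theorem countUpTo_eq_sum {S : Type*} (A : Set S) (w : ℕ → S) (n : ℕ) :
    countUpTo A w n = ∑ i ∈ Finset.range n, A.indicator (fun _ => 1) (w i) := by
  classical
  rw [countUpTo, Finset.card_filter]
  simp [indicator_apply]

theorem measurable_countUpTo {S : Type*} [MeasurableSpace S] {A : Set S} (hA : MeasurableSet A)
    (n : ℕ) : Measurable fun w : ℕ → S => countUpTo A w n := by
  simp_rw [countUpTo_eq_sum]
  exact Finset.measurable_sum _ fun i _ =>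
    (measurable_const.indicator hA).comp (measurable_pi_apply i)

theorem measurable_orderStat (n k : ℕ) : Measurable fun x : ℕ → ℝ => orderStat x n k := by
  by_cases hk : 1 ≤ k ∧ k ≤ n
  · obtain ⟨j, hj, rfl⟩ : ∃ j < n, k = n - j := ⟨n - k, by omega, by omega⟩
    refine measurable_of_Iic fun u => ?_
    have : (fun x : ℕ → ℝ => orderStat x n (n - j)) ⁻¹' Iic u
        = {x | countUpTo (Ioi u) x n ≤ j} := by
      ext x
      exact orderStat_le_iff x hj u
    rw [this]
    exact measurableSet_le (measurable_countUpTo measurableSet_Ioi n) measurable_const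
  · simp only [orderStat, dif_neg hk]
    exact measurable_const

theorem measurable_normUpperStats (a₁ b₁ a₂ b₂ : ℝ → ℝ) (m : ℕ) (s : ℝ) :
    Measurable fun p : (ℕ → ℝ × ℝ) × ℕ =>
      normUpperStats a₁ b₁ a₂ b₂ m s p.2 (fun i => (p.1 i).1) (fun i => (p.1 i).2) := by
  refine measurable_from_prod_countable_left fun n => ?_
  refine measurable_pi_lambda _ fun j => ?_
  have h1 : Measurable fun w : ℕ → ℝ × ℝ => orderStat (fun i => (w i).1) n (n - j) :=
    (measurable_orderStat n (n - j)).comp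
      (measurable_pi_lambda _ fun i => (measurable_pi_apply i).fst)
  have h2 : Measurable fun w : ℕ → ℝ × ℝ => orderStat (fun i => (w i).2) n (n - j) :=
    (measurable_orderStat n (n - j)).comp
      (measurable_pi_lambda _ fun i => (measurable_pi_apply i).snd)
  exact ((h1.sub_const _).div_const _).prodMk ((h2.sub_const _).div_const _)

/-- For `n ≥ m` the normalized upper order statistics lie below `v` iff the numbers of exceedances
are small. -/
theorem normUpperStats_le_iff {a₁ b₁ a₂ b₂ : ℝ → ℝ} {m : ℕ} {s : ℝ} {n : ℕ} (hn : m ≤ n)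
    (h₁ : 0 < a₁ s) (h₂ : 0 < a₂ s) (x y : ℕ → ℝ) (v : Fin m → ℝ × ℝ) :
    normUpperStats a₁ b₁ a₂ b₂ m s n x y ≤ v ↔
      ∀ j : Fin m, countUpTo (Ioi (a₁ s * (v j).1 + b₁ s)) x n ≤ j ∧
        countUpTo (Ioi (a₂ s * (v j).2 + b₂ s)) y n ≤ j := by
  rw [Pi.le_def]
  refine forall_congr' fun j => ?_
  rw [Prod.le_def]
  simp only [normUpperStats]
  rw [← orderStat_le_iff x (j.2.trans_le hn), ← orderStat_le_iff y (j.2.trans_le hn),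
    div_le_iff₀ h₁, div_le_iff₀ h₂, sub_le_iff_le_add, sub_le_iff_le_add, mul_comm (a₁ s),
    mul_comm (a₂ s)]

/-! ### Moments on the unit cube -/

/-- On the unit cube, moments determine the convergence of all expectations. -/
theorem exists_tendsto_integral_of_tendsto_moments {ι Ω : Type*} [Fintype ι] [MeasurableSpace Ω]
    (P : Measure Ω) [IsProbabilityMeasure P] (u : ℕ → Ω → ι → unitInterval)
    (hu : ∀ n, Measurable (u n))
    (hmom : ∀ k : ι →₀ ℕ, ∃ c, Tendsto (fun n => ∫ ω, ∏ i, (u n ω i : ℝ) ^ k i ∂P) atTop (𝓝 c))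
    (f : C(ι → unitInterval, ℝ)) :
    ∃ c, Tendsto (fun n => ∫ ω, f (u n ω) ∂P) atTop (𝓝 c) := by
  have hint : ∀ (f : C(ι → unitInterval, ℝ)) n, Integrable (fun ω => f (u n ω)) P := by
    intro f n
    refine Integrable.of_bound ((f.continuous.measurable.comp (hu n)).aestronglyMeasurable) ‖f‖
      (Eventually.of_forall fun ω => f.norm_coe_le_norm _)
  let X : ι → C(ι → unitInterval, ℝ) := fun i => ⟨fun v => (v i : ℝ), by fun_prop⟩
  have hpoly : ∀ p : MvPolynomial ι ℝ, ∃ c,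
      Tendsto (fun n => ∫ ω, (MvPolynomial.aeval X p) (u n ω) ∂P) atTop (𝓝 c) := by
    intro p
    induction p using MvPolynomial.induction_on' with
    | monomial k a =>
      obtain ⟨c, hc⟩ := hmom k
      refine ⟨a * c, (hc.const_mul a).congr fun n => ?_⟩
      rw [← integral_const_mul]
      refine integral_congr_ae (Eventually.of_forall fun ω => ?_)
      simp only [MvPolynomial.aeval_monomial, ContinuousMap.mul_apply,
        Finsupp.prod_fintype k _ fun i => pow_zero _, ContinuousMap.prod_apply,
        ContinuousMap.pow_apply]
      rfl
    | add p q hp hq =>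
      obtain ⟨c, hc⟩ := hp
      obtain ⟨d, hd⟩ := hq
      refine ⟨c + d, (hc.add hd).congr fun n => ?_⟩
      rw [← integral_add (hint _ n) (hint _ n)]
      simp
  -- Stone–Weierstrass: the coordinate functions already separate points. A uniform approximation by
  -- a polynomial then transfers the Cauchy property to `f`.
  have hdense : (MvPolynomial.aeval (R := ℝ) X).range.topologicalClosure = ⊤ := by
    refine ContinuousMap.subalgebra_topologicalClosure_eq_top_of_separatesPoints _ ?_
    intro v w hvw
    obtain ⟨i, hi⟩ := Function.ne_iff.mp hvw
    refine ⟨X i, ⟨X i, ⟨MvPolynomial.X i, by simp⟩, rfl⟩, ?_⟩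
    simpa [X, Subtype.ext_iff] using hi
  refine cauchySeq_tendsto_of_complete (Metric.cauchySeq_iff'.mpr fun ε hε => ?_)
  have hf : f ∈ closure ((MvPolynomial.aeval (R := ℝ) X).range : Set C(ι → unitInterval, ℝ)) := by
    have : f ∈ (MvPolynomial.aeval (R := ℝ) X).range.topologicalClosure := by
      rw [hdense]
      trivial
    exact this
  obtain ⟨g, ⟨p, rfl⟩, hg⟩ := Metric.mem_closure_iff.mp hf (ε / 4) (by positivity)
  obtain ⟨c, hc⟩ := hpoly p
  obtain ⟨M, hM⟩ := Metric.cauchySeq_iff'.mp hc.cauchySeq (ε / 4) (by positivity)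
  have hclose : ∀ n, dist (∫ ω, f (u n ω) ∂P) (∫ ω, (MvPolynomial.aeval X p) (u n ω) ∂P)
      ≤ ε / 4 := by
    intro n
    rw [dist_eq_norm, ← integral_sub (hint _ n) (hint _ n)]
    refine (norm_integral_le_of_norm_le_const (C := ε / 4)
      (Eventually.of_forall fun ω => ?_)).trans (by simp)
    rw [← dist_eq_norm]
    exact (ContinuousMap.dist_apply_le_dist _).trans hg.le
  refine ⟨M, fun n hn => ?_⟩
  have h1 := hclose n
  have h2 := hclose M
  have h3 := hM n hn
  rw [dist_comm] at h2
  have h4 := dist_triangle4 (∫ ω, f (u n ω) ∂P) (∫ ω, (MvPolynomial.aeval X p) (u n ω) ∂P)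
    (∫ ω, (MvPolynomial.aeval X p) (u M ω) ∂P) (∫ ω, f (u M ω) ∂P)
  linarith

/-! ### Poisson limits for counts of rare events -/

section Counts

variable {Ω S ι : Type*} [MeasurableSpace Ω] [MeasurableSpace S] [Fintype ι]
  {P : Measure Ω} {F : Measure S} {W : ℕ → Ω → S}

/-- The generating function of the numbers of visits of an iid sequence to finitely many sets. -/
theorem integral_prod_pow_countUpTo (hW : ∀ n, Measurable (W n)) (hindep : iIndepFun W P)
    (hlaw : ∀ n, P.map (W n) = F) {A : ι → Set S} (hA : ∀ i, MeasurableSet (A i)) (s : ι → ℝ)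
    (n : ℕ) :
    ∫ ω, ∏ i, s i ^ countUpTo (A i) (fun k => W k ω) n ∂P
      = (∫ w, ∏ i, ((A i).indicator (fun _ => s i) w + (A i)ᶜ.indicator (fun _ => 1) w) ∂F) ^ n := by
  classical
  set g : S → ℝ := fun w => ∏ i, ((A i).indicator (fun _ => s i) w +
    (A i)ᶜ.indicator (fun _ => 1) w) with hg
  have hgm : Measurable g := Finset.measurable_fun_prod _ fun i _ =>
    (measurable_const.indicator (hA i)).add (measurable_const.indicator (hA i).compl)
  have h1 : ∀ ω, ∏ i, s i ^ countUpTo (A i) (fun k => W k ω) n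
      = ∏ k : Fin n, g (W k ω) := by
    intro ω
    rw [← Finset.prod_range fun k => g (W k ω)]
    simp only [hg]
    rw [Finset.prod_comm]
    refine Finset.prod_congr rfl fun i _ => ?_
    rw [countUpTo_eq_sum, ← Finset.prod_pow_eq_pow_sum]
    refine Finset.prod_congr rfl fun k _ => ?_
    by_cases h : W k ω ∈ A i <;> simp [h]
  simp_rw [h1]
  have h2 := (hindep.precomp (Fin.val_injective (n := n))).integral_fun_prod_comp
    (f := fun _ => g) (fun i => (hW i).aemeasurable)
    (fun i => hgm.aestronglyMeasurable)
  rw [h2]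
  have h3 : ∀ k : Fin n, ∫ ω, g (W k ω) ∂P = ∫ w, g w ∂F := by
    intro k
    rw [← hlaw k, integral_map (hW k).aemeasurable hgm.aestronglyMeasurable]
  simp_rw [h3]
  simp

/-- Each factor equals `(1 - s i) * 1_{Aᵢᶜ} + s i`. Expanding the product leaves only complements of
unions, so convergence of the generating function reduces to convergence of the measures of the
unions. -/
theorem one_sub_integral_prod_eq_sum [DecidableEq ι] [IsProbabilityMeasure F] {A : ι → Set S}
    (hA : ∀ i, MeasurableSet (A i)) (s : ι → ℝ) :
    1 - ∫ w, ∏ i, ((A i).indicator (fun _ => s i) w + (A i)ᶜ.indicator (fun _ => 1) w) ∂F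
      = ∑ J ∈ Finset.univ.powerset,
          ((∏ i ∈ Finset.univ \ J, s i) * ∏ i ∈ J, (1 - s i)) * F.real (⋃ i ∈ J, A i) := by
  have hfac : ∀ i w, (A i).indicator (fun _ => s i) w + (A i)ᶜ.indicator (fun _ => 1) w
      = (1 - s i) * (A i)ᶜ.indicator (fun _ => 1) w + s i := by
    intro i w
    by_cases h : w ∈ A i <;> simp [h]
  have hmeas : ∀ J : Finset ι, MeasurableSet (⋃ i ∈ J, A i) := fun J =>
    Finset.measurableSet_biUnion J fun i _ => hA i
  have hexp : ∀ w, ∏ i, ((A i).indicator (fun _ => s i) w + (A i)ᶜ.indicator (fun _ => 1) w)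
      = ∑ J ∈ Finset.univ.powerset, ((∏ i ∈ Finset.univ \ J, s i) * ∏ i ∈ J, (1 - s i)) *
          (⋃ i ∈ J, A i)ᶜ.indicator (fun _ => (1 : ℝ)) w := by
    intro w
    simp_rw [hfac]
    rw [Finset.prod_add]
    refine Finset.sum_congr rfl fun J _ => ?_
    rw [Finset.prod_mul_distrib]
    have : ∏ i ∈ J, (A i)ᶜ.indicator (fun _ => (1 : ℝ)) w
        = (⋃ i ∈ J, A i)ᶜ.indicator (fun _ => (1 : ℝ)) w := by
      by_cases h : ∃ i ∈ J, w ∈ A i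
      · obtain ⟨i, hi, hw⟩ := h
        rw [Finset.prod_eq_zero hi (by simp [hw]), indicator_of_notMem]
        simpa using ⟨i, hi, hw⟩
      · push Not at h
        rw [Finset.prod_eq_one fun i hi => by simp [h i hi], indicator_of_mem]
        simpa using h
    rw [this]
    ring
  -- The coefficients add up to `∏ ((1 - s i) + s i) = 1`, so the `1` on the left can be distributed
  -- over the sum, replacing complements by the unions themselves.
  have hone : ∑ J ∈ Finset.univ.powerset,
      ((∏ i ∈ Finset.univ \ J, s i) * ∏ i ∈ J, (1 - s i)) = 1 := by
    have h := Finset.prod_add (fun i => 1 - s i) s Finset.univ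
    simp only [sub_add_cancel, Finset.prod_const_one] at h
    exact (Finset.sum_congr rfl fun J _ => mul_comm _ _).trans h.symm
  simp_rw [hexp]
  rw [integral_finsetSum _ fun J _ =>
    ((integrable_const _).indicator (hmeas J).compl).const_mul _]
  nth_rw 1 [← hone]
  rw [← Finset.sum_sub_distrib]
  refine Finset.sum_congr rfl fun J _ => ?_
  rw [integral_const_mul, integral_indicator (hmeas J).compl]
  simp only [integral_const, MeasurableSet.univ, measureReal_restrict_apply, univ_inter,
    smul_eq_mul, mul_one]
  rw [probReal_compl_eq_one_sub (hmeas J)]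
  ring

/-- A continuous function on the unit interval which separates the powers `2⁻¹ ^ c` with `c ≤ k`
from those with `k < c`. -/
theorem exists_continuous_separating_powers (k : ℕ) : ∃ φ : C(unitInterval, ℝ),
    ∀ (c : ℕ) (x : unitInterval), (x : ℝ) = 2⁻¹ ^ c → φ x = if c ≤ k then 1 else 0 := by
  -- At `x = 2⁻¹ ^ c` the inner affine function is `2 ^ (k + 1 - c) - 1`, which is at least `1` for
  -- `c ≤ k` and at most `0` for `c > k`.
  refine ⟨⟨fun x => max 0 (min 1 (2 ^ (k + 1) * (x : ℝ) - 1)), by fun_prop⟩, fun c x hx => ?_⟩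
  simp only [ContinuousMap.coe_mk, hx]
  split_ifs with h
  · have : (2 : ℝ) ≤ 2 ^ (k + 1) * 2⁻¹ ^ c := by
      rw [show k + 1 = (k - c) + 1 + c by omega, pow_add, mul_assoc, ← mul_pow]
      simp only [ne_eq, OfNat.ofNat_ne_zero, not_false_eq_true, mul_inv_cancel₀, one_pow, mul_one]
      exact le_self_pow₀ (by norm_num) (by omega)
    rw [min_eq_left (by linarith)]
    simp
  · have : (2 : ℝ) ^ (k + 1) * 2⁻¹ ^ c ≤ 1 := by
      rw [show c = k + 1 + (c - (k + 1)) by omega, pow_add 2⁻¹, ← mul_assoc, ← mul_pow]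
      simp only [ne_eq, OfNat.ofNat_ne_zero, not_false_eq_true, mul_inv_cancel₀, one_pow, one_mul]
      exact pow_le_one₀ (by norm_num) (by norm_num)
    exact max_eq_left (min_le_of_right_le (by linarith))

/-- A Poisson limit theorem for the joint numbers of visits to finitely many rare sets. -/
theorem exists_tendsto_measure_countUpTo_le [IsProbabilityMeasure P] [IsProbabilityMeasure F]
    (hW : ∀ n, Measurable (W n)) (hindep : iIndepFun W P) (hlaw : ∀ n, P.map (W n) = F)
    (A : ℕ → ι → Set S) (hA : ∀ n i, MeasurableSet (A n i))
    (hlim : ∀ J : Finset ι, J.Nonempty →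
      ∃ c, Tendsto (fun n : ℕ => (n : ℝ) * F.real (⋃ i ∈ J, A n i)) atTop (𝓝 c))
    (k : ι → ℕ) :
    ∃ c, Tendsto (fun n => P.real {ω | ∀ i, countUpTo (A n i) (fun l => W l ω) n ≤ k i})
      atTop (𝓝 c) := by
  classical
  have hpgf : ∀ s : ι → ℝ, ∃ c, Tendsto
      (fun n => ∫ ω, ∏ i, s i ^ countUpTo (A n i) (fun l => W l ω) n ∂P) atTop (𝓝 c) := by
    intro s
    have hJ : ∀ J : Finset ι, ∃ c, Tendsto (fun n : ℕ => (n : ℝ) * F.real (⋃ i ∈ J, A n i))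
        atTop (𝓝 c) := by
      intro J
      rcases J.eq_empty_or_nonempty with rfl | h
      · exact ⟨0, by simp⟩
      · exact hlim J h
    choose c hc using hJ
    have hsum := tendsto_finsetSum Finset.univ.powerset fun J _ =>
      (hc J).const_mul ((∏ i ∈ Finset.univ \ J, s i) * ∏ i ∈ J, (1 - s i))
    have hexp := Real.tendsto_one_add_pow_exp_of_tendsto (hsum.neg.congr fun n => by
      rw [show -∑ J ∈ Finset.univ.powerset, ((∏ i ∈ Finset.univ \ J, s i) * ∏ i ∈ J, (1 - s i)) *
          ((n : ℝ) * F.real (⋃ i ∈ J, A n i)) = (n : ℝ) * (-∑ J ∈ Finset.univ.powerset,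
          ((∏ i ∈ Finset.univ \ J, s i) * ∏ i ∈ J, (1 - s i)) * F.real (⋃ i ∈ J, A n i)) by
        rw [mul_neg, Finset.mul_sum]
        congr 1
        exact Finset.sum_congr rfl fun J _ => by ring])
    refine ⟨_, hexp.congr fun n => ?_⟩
    rw [integral_prod_pow_countUpTo hW hindep hlaw (hA n), ← one_sub_integral_prod_eq_sum (hA n)]
    congr 1
    ring
  have hcm : ∀ n i, Measurable fun ω => countUpTo (A n i) (fun l => W l ω) n := fun n i =>
    (measurable_countUpTo (hA n i) n).comp (measurable_pi_lambda _ hW)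
  -- Counts are unbounded, but their images `2⁻¹ ^ count` lie in a compact cube, and the mixed
  -- moments of these images are values of the generating function at `s i = 2⁻¹ ^ l i`.
  let u : ℕ → Ω → ι → unitInterval := fun n ω i =>
    ⟨2⁻¹ ^ countUpTo (A n i) (fun l => W l ω) n, by positivity,
      pow_le_one₀ (by norm_num) (by norm_num)⟩
  have hu : ∀ n, Measurable (u n) := fun n => measurable_pi_lambda _ fun i =>
    (measurable_const.pow (hcm n i)).subtype_mk
  choose φ hφ using fun i => exists_continuous_separating_powers (k i)
  obtain ⟨c, hc⟩ := exists_tendsto_integral_of_tendsto_moments P u hu (fun l => by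
    obtain ⟨c, hc⟩ := hpgf fun i => 2⁻¹ ^ l i
    refine ⟨c, hc.congr fun n => ?_⟩
    refine integral_congr_ae (Eventually.of_forall fun ω => Finset.prod_congr rfl fun i _ => ?_)
    simp only [u]
    rw [← pow_mul, ← pow_mul, mul_comm]) ⟨fun v => ∏ i, φ i (v i), by fun_prop⟩
  refine ⟨c, hc.congr fun n => ?_⟩
  have hset : MeasurableSet {ω | ∀ i, countUpTo (A n i) (fun l => W l ω) n ≤ k i} := by
    rw [Set.ofPred_forall]
    exact MeasurableSet.iInter fun i => measurableSet_le (hcm n i) measurable_const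
  rw [← integral_indicator_one hset]
  refine integral_congr_ae (Eventually.of_forall fun ω => ?_)
  simp only [ContinuousMap.coe_mk]
  rw [Finset.prod_congr rfl fun i _ => hφ i _ (u n ω i) rfl]
  by_cases h : ∀ i, countUpTo (A n i) (fun l => W l ω) n ≤ k i
  · rw [indicator_of_mem (by exact h)]
    simp [h]
  · rw [indicator_of_notMem (by exact h)]
    push Not at h
    obtain ⟨i, hi⟩ := h
    exact Finset.prod_eq_zero (Finset.mem_univ i) (by simp [hi])

end Counts

/-! ### Distribution functions and weak convergence -/

/-- A measurable partial order whose measures are determined by lower rays, which can be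
approximated from outside by lower rays containing them in their interiors. -/
structure CdfDetermining (E : Type*) [TopologicalSpace E] [MeasurableSpace E] [Preorder E] :
    Prop where
  ext : ∀ μ ν : Measure E, IsProbabilityMeasure μ → IsProbabilityMeasure ν →
    (∀ v, μ (Iic v) = ν (Iic v)) → μ = ν
  approx : ∀ v : E, ∃ u : ℕ → E, Antitone u ∧ (∀ n, Iic v ⊆ interior (Iic (u n))) ∧
    ⋂ n, Iic (u n) ⊆ Iic v

theorem generateFrom_range_Iic_real :
    MeasurableSpace.generateFrom (range (Iic : ℝ → Set ℝ)) = borel ℝ :=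
  (borel_eq_generateFrom_Iic ℝ).symm

theorem isCountablySpanning_range_Iic_real : IsCountablySpanning (range (Iic : ℝ → Set ℝ)) :=
  ⟨fun n => Iic n, fun n => ⟨n, rfl⟩, by
    ext x
    simpa using exists_nat_ge x⟩

theorem generateFrom_range_Iic_prod :
    MeasurableSpace.generateFrom (range (Iic : ℝ × ℝ → Set (ℝ × ℝ))) = Prod.instMeasurableSpace := by
  have h : range (Iic : ℝ × ℝ → Set (ℝ × ℝ))
      = image2 (· ×ˢ ·) (range (Iic : ℝ → Set ℝ)) (range (Iic : ℝ → Set ℝ)) := by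
    ext s
    simp only [mem_range, mem_image2, exists_exists_eq_and, Prod.exists, Iic_prod_Iic]
  rw [h]
  refine generateFrom_eq_prod ?_ ?_ isCountablySpanning_range_Iic_real
    isCountablySpanning_range_Iic_real
  all_goals rw [generateFrom_range_Iic_real, BorelSpace.measurable_eq (α := ℝ)]

theorem isCountablySpanning_range_Iic_prod :
    IsCountablySpanning (range (Iic : ℝ × ℝ → Set (ℝ × ℝ))) :=
  ⟨fun n => Iic ((n : ℝ), (n : ℝ)), fun n => ⟨_, rfl⟩, by
    ext x
    obtain ⟨n, hn⟩ := exists_nat_ge (max x.1 x.2)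
    simp only [mem_iUnion, mem_Iic, mem_univ, iff_true]
    exact ⟨n, (le_max_left _ _).trans hn, (le_max_right _ _).trans hn⟩⟩

theorem generateFrom_range_Iic_pi (ι : Type*) [Finite ι] :
    MeasurableSpace.generateFrom (range (Iic : (ι → ℝ × ℝ) → Set (ι → ℝ × ℝ)))
      = MeasurableSpace.pi := by
  have h : range (Iic : (ι → ℝ × ℝ) → Set (ι → ℝ × ℝ))
      = pi univ '' pi univ (fun _ : ι => range (Iic : ℝ × ℝ → Set (ℝ × ℝ))) := by
    ext s
    constructor
    · rintro ⟨v, rfl⟩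
      exact ⟨fun i => Iic (v i), fun i _ => ⟨v i, rfl⟩, pi_univ_Iic v⟩
    · rintro ⟨t, ht, rfl⟩
      choose v hv using fun i => ht i (mem_univ i)
      exact ⟨v, by rw [← pi_univ_Iic]; simp_rw [hv]⟩
  rw [h]
  exact generateFrom_eq_pi (fun _ => generateFrom_range_Iic_prod)
    fun _ => isCountablySpanning_range_Iic_prod

theorem isPiSystem_range_Iic {E : Type*} [SemilatticeInf E] :
    IsPiSystem (range (Iic : E → Set E)) := by
  rintro _ ⟨a, rfl⟩ _ ⟨b, rfl⟩ _
  exact ⟨a ⊓ b, (Iic_inter_Iic).symm⟩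

theorem Measure.ext_of_Iic_of_generateFrom {E : Type*} [SemilatticeInf E] {mE : MeasurableSpace E}
    (hE : MeasurableSpace.generateFrom (range (Iic : E → Set E)) = mE) (μ ν : Measure E)
    (hμ : IsProbabilityMeasure μ) (hν : IsProbabilityMeasure ν)
    (h : ∀ v, μ (Iic v) = ν (Iic v)) : μ = ν := by
  refine ext_of_generate_finite _ hE.symm isPiSystem_range_Iic ?_ (by simp)
  rintro _ ⟨v, rfl⟩
  exact h v

theorem exists_approx_Iic_prod (v : ℝ × ℝ) :
    let u : ℕ → ℝ × ℝ := fun n => v + (1 / ((n : ℝ) + 1), 1 / ((n : ℝ) + 1))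
    Antitone u ∧ (∀ n, Iic v ⊆ interior (Iic (u n))) ∧ ⋂ n, Iic (u n) ⊆ Iic v := by
  intro u
  have hanti : Antitone fun n : ℕ => 1 / ((n : ℝ) + 1) := fun a b hab => by
    simp only
    gcongr
  refine ⟨fun a b hab => ?_, fun n => ?_, fun w hw => ?_⟩
  · exact add_le_add le_rfl (Prod.mk_le_mk.mpr ⟨hanti hab, hanti hab⟩)
  · have hpos : (0 : ℝ) < 1 / ((n : ℝ) + 1) := by positivity
    refine Subset.trans (b := Iio (u n).1 ×ˢ Iio (u n).2) (fun w hw => ?_) ?_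
    · have hw1 : w.1 ≤ v.1 := hw.1
      have hw2 : w.2 ≤ v.2 := hw.2
      exact ⟨show w.1 < v.1 + _ by linarith, show w.2 < v.2 + _ by linarith⟩
    · refine interior_maximal (fun w hw => ?_) (isOpen_Iio.prod isOpen_Iio)
      exact ⟨hw.1.le, hw.2.le⟩
  · have hlim : Tendsto u atTop (𝓝 v) := by
      have h0 : Tendsto (fun n : ℕ => 1 / ((n : ℝ) + 1)) atTop (𝓝 0) :=
        tendsto_one_div_add_atTop_nhds_zero_nat
      have h := (tendsto_const_nhds (x := v)).add (h0.prodMk_nhds h0)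
      rwa [Prod.mk_zero_zero, add_zero] at h
    exact ge_of_tendsto' hlim fun n => mem_iInter.mp hw n

theorem cdfDetermining_prod : CdfDetermining (ℝ × ℝ) where
  ext := Measure.ext_of_Iic_of_generateFrom generateFrom_range_Iic_prod
  approx v := ⟨_, exists_approx_Iic_prod v⟩

theorem cdfDetermining_pi (ι : Type*) [Finite ι] : CdfDetermining (ι → ℝ × ℝ) where
  ext := Measure.ext_of_Iic_of_generateFrom (generateFrom_range_Iic_pi ι)
  approx v := by
    refine ⟨fun n i => v i + (1 / ((n : ℝ) + 1), 1 / ((n : ℝ) + 1)),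
      fun a b hab i => (exists_approx_Iic_prod (v i)).1 hab, fun n => ?_, fun w hw i => ?_⟩
    · rw [← pi_univ_Iic, ← pi_univ_Iic, interior_pi_set finite_univ]
      exact pi_mono fun i _ => (exists_approx_Iic_prod (v i)).2.1 n
    · exact (exists_approx_Iic_prod (v i)).2.2
        (mem_iInter.mpr fun n => mem_iInter.mp hw n i)

section

variable {E : Type*} [TopologicalSpace E] [MeasurableSpace E] [Preorder E]

/-- `ν` has the distribution function `L`, up to regularization from the right. -/
def HasRegularizedCdf (L : E → ℝ) (ν : Measure E) : Prop :=
  (∀ v, L v ≤ ν.real (Iic v)) ∧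
    ∀ v u, Iic v ⊆ interior (Iic u) → ν.real (Iic v) ≤ L u

/-- Portmanteau, applied to the closed ray `Iic v` for the lower bound and to the interior of `Iic
u` for the upper one. No continuity of `L` is required. -/
theorem hasRegularizedCdf_of_tendsto [OpensMeasurableSpace E] [HasOuterApproxClosed E]
    [ClosedIicTopology E] {ι : Type*} {l : Filter ι} [l.NeBot]
    {μ : ι → ProbabilityMeasure E} {ν : ProbabilityMeasure E} {L : E → ℝ}
    (hμ : Tendsto μ l (𝓝 ν))
    (hL : ∀ v, Tendsto (fun i => (μ i : Measure E).real (Iic v)) l (𝓝 (L v))) :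
    HasRegularizedCdf L (ν : Measure E) := by
  have hL' : ∀ v, Tendsto (fun i => (μ i : Measure E) (Iic v)) l (𝓝 (ENNReal.ofReal (L v))) := by
    intro v
    refine ((ENNReal.continuous_ofReal.tendsto _).comp (hL v)).congr fun i => ?_
    simp [Measure.real]
  have h0 : ∀ v, 0 ≤ L v := fun v => ge_of_tendsto' (hL v) fun i => measureReal_nonneg
  refine ⟨fun v => ?_, fun v u hvu => ?_⟩
  · have h := ProbabilityMeasure.limsup_measure_closed_le_of_tendsto hμ (isClosed_Iic (a := v))
    rw [(hL' v).limsup_eq] at h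
    exact (ENNReal.ofReal_le_iff_le_toReal (measure_ne_top _ _)).mp h
  · have h := ProbabilityMeasure.le_liminf_measure_open_of_tendsto hμ
      (isOpen_interior (s := Iic u))
    have h2 : l.liminf (fun i => (μ i : Measure E) (interior (Iic u)))
        ≤ ENNReal.ofReal (L u) := by
      rw [← (hL' u).liminf_eq]
      exact liminf_le_liminf (Eventually.of_forall fun i => measure_mono interior_subset)
    exact ENNReal.toReal_le_of_le_ofReal (h0 u) ((measure_mono hvu).trans (h.trans h2))

theorem hasRegularizedCdf_of_eq {L : E → ℝ} {ν : Measure E} [IsFiniteMeasure ν]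
    (h : ∀ v, ν.real (Iic v) = L v) : HasRegularizedCdf L ν :=
  ⟨fun v => (h v).ge, fun v u hvu => (h u) ▸ measureReal_mono (hvu.trans interior_subset)⟩

/-- For outer approximations `u n` of `v`, `μ (Iic v) ≤ L (u n) ≤ ν (Iic (u n))`, and the right side
decreases to at most `ν (Iic v)`. -/
theorem HasRegularizedCdf.le [OpensMeasurableSpace E] [ClosedIicTopology E]
    {L : E → ℝ} {μ ν : Measure E} [IsProbabilityMeasure μ]
    [IsProbabilityMeasure ν] (hE : CdfDetermining E)
    (hμ : HasRegularizedCdf L μ) (hν : HasRegularizedCdf L ν) (v : E) :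
    μ (Iic v) ≤ ν (Iic v) := by
  obtain ⟨u, hu, hvu, hinter⟩ := hE.approx v
  have hlim := tendsto_measure_iInter_atTop (μ := ν) (s := fun n => Iic (u n))
    (fun n => measurableSet_Iic.nullMeasurableSet)
    (fun a b hab => Iic_subset_Iic.mpr (hu hab)) ⟨0, measure_ne_top _ _⟩
  refine (ge_of_tendsto' hlim fun n => ?_).trans (measure_mono hinter)
  have h := (hμ.2 v (u n) (hvu n)).trans (hν.1 (u n))
  exact (ENNReal.toReal_le_toReal (measure_ne_top _ _) (measure_ne_top _ _)).mp h

theorem HasRegularizedCdf.unique [OpensMeasurableSpace E] [ClosedIicTopology E]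
    {L : E → ℝ} {μ ν : Measure E} [IsProbabilityMeasure μ]
    [IsProbabilityMeasure ν] (hE : CdfDetermining E)
    (hμ : HasRegularizedCdf L μ) (hν : HasRegularizedCdf L ν) : μ = ν :=
  hE.ext μ ν inferInstance inferInstance fun v =>
    le_antisymm (hμ.le hE hν v) (hν.le hE hμ v)

end

/-- **Helly–Bray**: a tight sequence whose distribution functions converge everywhere converges
weakly. -/
theorem exists_tendsto_of_isTight_of_tendsto_cdf {E : Type*} [TopologicalSpace E] [T2Space E]
    [MeasurableSpace E] [BorelSpace E] [Preorder E] [HasOuterApproxClosed E]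
    [ClosedIicTopology E] [NormalSpace E] (hE : CdfDetermining E) (μ : ℕ → ProbabilityMeasure E)
    (htight : IsTightMeasureSet (range fun n => (μ n : Measure E))) (L : E → ℝ)
    (hL : ∀ v, Tendsto (fun n => (μ n : Measure E).real (Iic v)) atTop (𝓝 (L v))) :
    ∃ ν : ProbabilityMeasure E, Tendsto μ atTop (𝓝 ν) := by
  have hK : IsCompact (closure (range μ)) := by
    refine isCompact_closure_of_isTightMeasureSet (htight.subset ?_)
    rintro _ ⟨_, ⟨n, rfl⟩, rfl⟩
    exact ⟨n, rfl⟩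
  have hmem : ∀ n, μ n ∈ closure (range μ) := fun n => subset_closure ⟨n, rfl⟩
  have hreg : ∀ ν : ProbabilityMeasure E, MapClusterPt ν atTop μ →
      HasRegularizedCdf L (ν : Measure E) := by
    intro ν hν
    -- Convergence along an ultrafilter replaces the extraction of a subsequence.
    obtain ⟨U, hU, hUν⟩ := mapClusterPt_iff_ultrafilter.mp hν
    exact hasRegularizedCdf_of_tendsto hUν fun v => (hL v).mono_left hU
  obtain ⟨ν, -, hν⟩ := hK.exists_mapClusterPt_of_frequently (l := atTop) (f := μ)
    (Frequently.of_forall hmem)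
  refine ⟨ν, hK.tendsto_nhds_of_unique_mapClusterPt (Eventually.of_forall hmem)
    fun ν' _ hν' => ?_⟩
  have := ν'.2
  have := ν.2
  exact Subtype.ext (HasRegularizedCdf.unique (μ := (ν' : Measure E)) (ν := (ν : Measure E)) hE
    (hreg ν' hν') (hreg ν hν))

/-! ### Extreme value distributions and convergence of types -/

namespace ExtremeType

/-- The open interval on which an extreme value distribution function increases strictly. -/
def support : ExtremeType → Set ℝ
  | frechet _ _ => Ioi 0
  | weibull _ _ => Iio 0
  | gumbel => univ

theorem distFun_strictMonoOn (K : ExtremeType) : StrictMonoOn K.distFun K.support := by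
  intro v hv w hw hvw
  cases K with
  | frechet α hα =>
    have hv' : 0 < v := hv
    have hw' : 0 < w := hw
    simp only [distFun, if_pos hv', if_pos hw']
    exact Real.exp_lt_exp.mpr (neg_lt_neg
      (Real.rpow_lt_rpow_of_neg hv' hvw (neg_neg_of_pos hα)))
  | weibull α hα =>
    have hv' : v < 0 := hv
    have hw' : w < 0 := hw
    simp only [distFun, if_pos hv', if_pos hw']
    refine Real.exp_lt_exp.mpr (neg_lt_neg (Real.rpow_lt_rpow (abs_nonneg _) ?_ hα))
    rw [abs_of_neg hv', abs_of_neg hw']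
    linarith
  | gumbel =>
    simp only [distFun]
    exact Real.exp_lt_exp.mpr (neg_lt_neg (Real.exp_lt_exp.mpr (by linarith)))

theorem isOpen_support (K : ExtremeType) : IsOpen K.support := by
  cases K
  exacts [isOpen_Ioi, isOpen_Iio, isOpen_univ]

theorem exists_ne_mem_support (K : ExtremeType) : ∃ x ∈ K.support, ∃ y ∈ K.support, x ≠ y := by
  cases K with
  | frechet α hα => exact ⟨1, by norm_num [support], 2, by norm_num [support], by norm_num⟩
  | weibull α hα => exact ⟨-1, by norm_num [support], -2, by norm_num [support], by norm_num⟩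
  | gumbel => exact ⟨0, mem_univ _, 1, mem_univ _, by norm_num⟩

theorem rescale_mem_support (K : ExtremeType) {x z : ℝ} (hx : x ∈ K.support) (hz : 0 < z) :
    z ^ K.gamma * x + K.delta z ∈ K.support := by
  have hz' : 0 < z ^ K.gamma := Real.rpow_pos_of_pos hz _
  cases K with
  | frechet α hα =>
    simp only [delta, add_zero]
    exact mul_pos hz' hx
  | weibull α hα =>
    simp only [delta, add_zero]
    exact mul_neg_of_pos_of_neg hz' hx
  | gumbel => exact mem_univ _

/-- Max-stability of the standard extreme value distributions. -/
theorem distFun_rpow_one_div (K : ExtremeType) {x z : ℝ} (hx : x ∈ K.support) (hz : 0 < z) :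
    K.distFun x ^ (1 / z) = K.distFun (z ^ K.gamma * x + K.delta z) := by
  have hmem := K.rescale_mem_support hx hz
  cases K with
  | frechet α hα =>
    have hx' : 0 < x := hx
    have hm' : 0 < z ^ (frechet α hα).gamma * x + (frechet α hα).delta z := hmem
    simp only [distFun, if_pos hx', if_pos hm']
    simp only [gamma, delta, add_zero]
    rw [← Real.exp_mul, Real.mul_rpow (Real.rpow_nonneg hz.le _) hx'.le, ← Real.rpow_mul hz.le,
      show 1 / α * -α = -1 by field_simp, Real.rpow_neg_one]
    congr 1
    field_simp
  | weibull α hα =>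
    have hx' : x < 0 := hx
    have hm' : z ^ (weibull α hα).gamma * x + (weibull α hα).delta z < 0 := hmem
    simp only [distFun, if_pos hx', if_pos hm']
    simp only [gamma, delta, add_zero]
    rw [← Real.exp_mul, abs_mul, abs_of_pos (Real.rpow_pos_of_pos hz _),
      Real.mul_rpow (Real.rpow_nonneg hz.le _) (abs_nonneg _), ← Real.rpow_mul hz.le,
      show -1 / α * α = -1 by field_simp, Real.rpow_neg_one]
    congr 1
    field_simp
  | gumbel =>
    simp only [distFun, gamma, delta, Real.rpow_zero, one_mul]
    rw [← Real.exp_mul, neg_add, Real.exp_add, Real.exp_neg (Real.log z), Real.exp_log hz]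
    congr 1
    field_simp

end ExtremeType

/-- Convergence of the values of a monotone function at a point of strict increase forces
convergence of the arguments. -/
theorem tendsto_of_tendsto_comp_of_strictMonoOn {ι : Type*} {l : Filter ι} {f : ℝ → ℝ}
    (hf : Monotone f) {s : Set ℝ} (hs : IsOpen s) (hfs : StrictMonoOn f s) {w : ℝ} (hw : w ∈ s)
    {u : ι → ℝ} (h : Tendsto (fun i => f (u i)) l (𝓝 (f w))) : Tendsto u l (𝓝 w) := by
  refine tendsto_order.mpr ⟨fun v hv => ?_, fun v hv => ?_⟩
  · obtain ⟨c, hc, hcs⟩ := exists_Ioc_subset_of_mem_nhds (hs.mem_nhds hw) ⟨v, hv⟩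
    obtain ⟨d, hd, hdw⟩ := exists_between (max_lt hc hv)
    have hds : d ∈ s := hcs ⟨(le_max_left _ _).trans_lt hd, hdw.le⟩
    filter_upwards [h.eventually_const_lt (hfs hds hw hdw)] with i hi
    exact ((le_max_right _ _).trans hd.le).trans_lt (hf.reflect_lt hi)
  · obtain ⟨c, hc, hcs⟩ := exists_Ico_subset_of_mem_nhds (hs.mem_nhds hw) ⟨v, hv⟩
    obtain ⟨d, hdw, hd⟩ := exists_between (lt_min hc hv)
    have hds : d ∈ s := hcs ⟨hdw.le, hd.trans_le (min_le_left _ _)⟩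
    filter_upwards [h.eventually_lt_const (hfs hw hds hdw)] with i hi
    exact (hf.reflect_lt hi).trans_le (hd.le.trans (min_le_right _ _))

/-- **Convergence of types** for the norming functions of an extreme value limit. -/
theorem tendsto_norming_ratio {ι : Type*} {l : Filter ι} {G a b : ℝ → ℝ} {K : ExtremeType}
    (hK : Monotone K.distFun) (hG : ∀ x, 0 ≤ G x) (ha : ∀ᶠ t in atTop, 0 < a t)
    (hU : TendstoUniformly (fun t x => G (a t * x + b t) ^ t) K.distFun atTop)
    {s t : ι → ℝ} (hs : Tendsto s l atTop) (ht : Tendsto t l atTop) {z : ℝ} (hz : 0 < z)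
    (hst : Tendsto (fun i => s i / t i) l (𝓝 z)) :
    Tendsto (fun i => a (s i) / a (t i)) l (𝓝 (z ^ K.gamma)) ∧
      Tendsto (fun i => (b (s i) - b (t i)) / a (t i)) l (𝓝 (K.delta z)) := by
  have hat : ∀ᶠ i in l, 0 < a (t i) := ht.eventually ha
  have hkey : ∀ x ∈ K.support, Tendsto
      (fun i => a (s i) / a (t i) * x + (b (s i) - b (t i)) / a (t i)) l
      (𝓝 (z ^ K.gamma * x + K.delta z)) := by
    intro x hx
    refine tendsto_of_tendsto_comp_of_strictMonoOn hK K.isOpen_support K.distFun_strictMonoOn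
      (K.rescale_mem_support hx hz) ?_
    rw [← K.distFun_rpow_one_div hx hz]
    have h1 : Tendsto (fun i => (G (a (s i) * x + b (s i)) ^ s i) ^ (t i / s i)) l
        (𝓝 (K.distFun x ^ (1 / z))) := by
      refine ((hU.tendsto_at x).comp hs).rpow ?_ (Or.inr (by positivity))
      simpa using hst.inv₀ hz.ne'
    have h2 : Tendsto (fun i =>
        G (a (t i) * (a (s i) / a (t i) * x + (b (s i) - b (t i)) / a (t i)) + b (t i)) ^ t i) l
        (𝓝 (K.distFun x ^ (1 / z))) := by
      refine h1.congr' ?_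
      filter_upwards [hat, hs.eventually_gt_atTop 0] with i hi hsi
      rw [← Real.rpow_mul (hG _), mul_div_cancel₀ _ hsi.ne']
      congr 2
      field_simp
      ring
    -- The evaluation point moves with `i` and is not yet known to converge; uniformity of the
    -- convergence is what allows `G ^ t` to be replaced by the limit there.
    have h3 : Tendsto (fun i =>
        K.distFun (a (s i) / a (t i) * x + (b (s i) - b (t i)) / a (t i)) -
        G (a (t i) * (a (s i) / a (t i) * x + (b (s i) - b (t i)) / a (t i)) + b (t i)) ^ t i) l
        (𝓝 0) := by
      refine Metric.tendsto_nhds.mpr fun ε hε => ?_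
      filter_upwards [ht.eventually (Metric.tendstoUniformly_iff.mp hU ε hε)] with i hi
      have h := hi (a (s i) / a (t i) * x + (b (s i) - b (t i)) / a (t i))
      rwa [dist_zero_right, ← dist_eq_norm]
    simpa using h3.add h2
  -- Convergence of an affine function at two distinct points determines the limits of its slope and
  -- intercept.
  obtain ⟨x, hx, y, hy, hxy⟩ := K.exists_ne_mem_support
  have hxy' : x - y ≠ 0 := sub_ne_zero.mpr hxy
  have hA : Tendsto (fun i => a (s i) / a (t i)) l (𝓝 (z ^ K.gamma)) := by
    have h := ((hkey x hx).sub (hkey y hy)).div_const (x - y)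
    convert! h using 2
    · field_simp
      ring
    · field_simp
      ring
  refine ⟨hA, ?_⟩
  have h := (hkey x hx).sub (hA.mul_const x)
  simpa using h

/-! ### Extended continuous mapping -/

/-- **Extended continuous mapping theorem**: if `μ i → μ₀` weakly and the bounded functions `h i`
converge continuously to `h₀` on an open set of full measure, then the integrals converge. -/
theorem tendsto_integral_of_continuousConvergence {S ι : Type*} [TopologicalSpace S] [T2Space S]
    [LocallyCompactSpace S] [MeasurableSpace S] [BorelSpace S] {l : Filter ι}
    {μ : ι → ProbabilityMeasure S} {μ₀ : ProbabilityMeasure S}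
    (hμ : Tendsto μ l (𝓝 μ₀)) (hreg : (μ₀ : Measure S).Regular) {D : Set S} (hD : IsOpen D) (hDμ : (μ₀ : Measure S) D = 1)
    {h : ι → S → ℝ} {h₀ : S → ℝ} (hm : ∀ i, Measurable (h i)) (hm₀ : Measurable h₀) {C : ℝ}
    (hC : ∀ i x, |h i x| ≤ C) (hC₀ : ∀ x, |h₀ x| ≤ C) (hcont : ContinuousOn h₀ D)
    (hlim : ∀ x ∈ D, Tendsto (fun p : ι × S => h p.1 p.2) (l ×ˢ 𝓝 x) (𝓝 (h₀ x))) :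
    Tendsto (fun i => ∫ x, h i x ∂(μ i : Measure S)) l (𝓝 (∫ x, h₀ x ∂(μ₀ : Measure S))) := by
  -- Continuous convergence to a continuous limit is locally uniform convergence.
  have hloc : TendstoLocallyUniformlyOn h h₀ l D := by
    rw [tendstoLocallyUniformlyOn_iff_filter]
    intro x hx
    rw [hD.nhdsWithin_eq hx, tendstoUniformlyOnFilter_iff_tendsto,
      Metric.uniformity_eq_comap_nhds_zero, tendsto_comap_iff]
    have h2 : Tendsto (fun p : ι × S => h₀ p.2) (l ×ˢ 𝓝 x) (𝓝 (h₀ x)) :=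
      (hcont.continuousAt (hD.mem_nhds hx)).tendsto.comp tendsto_snd
    have h3 := h2.dist (hlim x hx)
    rwa [dist_self] at h3
  have hC0 : 0 ≤ C := by
    obtain ⟨x⟩ : Nonempty S := (μ₀ : Measure S).nonempty_of_neZero
    exact (abs_nonneg _).trans (hC₀ x)
  -- The final error is `(2 + 3 * C) * ε`: one `ε` for weak convergence of `h₀ * χ`, one for uniform
  -- convergence on the support of `χ`, and cutoff errors `2 * C * ε` for `μ i` and `C * ε` for
  -- `μ₀`.
  refine Metric.tendsto_nhds.mpr fun ε' hε' => ?_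
  obtain ⟨ε, hε, hε2⟩ : ∃ ε > 0, (2 + 3 * C) * ε < ε' := by
    refine ⟨ε' / (2 * (2 + 3 * C)), by positivity, ?_⟩
    field_simp
    linarith
  obtain ⟨K, hKD, hK, hKμ⟩ := hD.exists_lt_isCompact (μ := (μ₀ : Measure S))
    (r := ENNReal.ofReal (1 - ε)) (by
      rw [hDμ, ← ENNReal.ofReal_one]
      exact (ENNReal.ofReal_lt_ofReal_iff one_pos).mpr (by linarith))
  obtain ⟨χ, hχK, hχc, hχD, hχ⟩ := exists_continuousMap_one_of_isCompact_subset_isOpen hK hD hKD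
  have habs : ∀ x, |χ x| ≤ 1 := fun x => abs_le.mpr ⟨by linarith [(hχ x).1], (hχ x).2⟩
  have hcont₀ : Continuous fun x => h₀ x * χ x := by
    refine ContinuousOn.continuous_of_tsupport_subset
      (hcont.mul χ.continuous.continuousOn) hD ?_
    exact (tsupport_mul_subset_right (f := h₀) (g := χ)).trans hχD
  have hunif := (tendstoLocallyUniformlyOn_iff_forall_isCompact hD).mp hloc _ hχD hχc
  have hb : ∀ {f : S → ℝ}, (∀ x, |f x| ≤ C) → ∀ x, |f x * χ x| ≤ C := by
    intro f hf x
    rw [abs_mul]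
    exact (mul_le_mul (hf x) (habs x) (abs_nonneg _) hC0).trans (mul_one C).le
  have hint : ∀ (ν : ProbabilityMeasure S) {f : S → ℝ}, Measurable f → (∀ x, |f x| ≤ C) →
      Integrable f (ν : Measure S) := fun ν f hfm hf =>
    Integrable.of_bound hfm.aestronglyMeasurable C (Eventually.of_forall hf)
  have hmul : ∀ {f : S → ℝ}, Measurable f → Measurable fun x => f x * χ x := fun hf =>
    hf.mul χ.continuous.measurable
  have hχint : ∀ ν : ProbabilityMeasure S, Integrable (fun x => χ x) (ν : Measure S) := fun ν =>
    Integrable.of_bound χ.continuous.measurable.aestronglyMeasurable 1 (Eventually.of_forall habs)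
  have htail : ∀ (ν : ProbabilityMeasure S) {f : S → ℝ}, Measurable f → (∀ x, |f x| ≤ C) →
      |∫ x, f x ∂(ν : Measure S) - ∫ x, f x * χ x ∂(ν : Measure S)|
        ≤ C * (1 - ∫ x, χ x ∂(ν : Measure S)) := by
    intro ν f hfm hf
    rw [← integral_sub (hint ν hfm hf) (hint ν (hmul hfm) (hb hf))]
    have h1 : 1 - ∫ x, χ x ∂(ν : Measure S) = ∫ x, (1 - χ x) ∂(ν : Measure S) := by
      rw [integral_sub (integrable_const _) (hχint ν)]
      simp
    rw [h1, ← integral_const_mul, ← Real.norm_eq_abs]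
    refine norm_integral_le_of_norm_le (((integrable_const _).sub (hχint ν)).const_mul C)
      (Eventually.of_forall fun x => ?_)
    rw [show f x - f x * χ x = f x * (1 - χ x) by ring, norm_mul,
      Real.norm_of_nonneg (sub_nonneg.mpr (hχ x).2)]
    exact mul_le_mul_of_nonneg_right (hf x) (sub_nonneg.mpr (hχ x).2)
  have hweak : ∀ {f : S → ℝ} {c : ℝ}, Continuous f → (∀ x, |f x| ≤ c) →
      Tendsto (fun i => ∫ x, f x ∂(μ i : Measure S)) l (𝓝 (∫ x, f x ∂(μ₀ : Measure S))) := by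
    intro f c hf hfc
    exact ProbabilityMeasure.tendsto_iff_forall_integral_tendsto.mp hμ
      (BoundedContinuousFunction.ofNormedAddCommGroup f hf c hfc)
  have hχμ₀ : 1 - ε ≤ ∫ x, χ x ∂(μ₀ : Measure S) := by
    have h1 : (1 - ε) ≤ (μ₀ : Measure S).real K :=
      (ENNReal.ofReal_le_iff_le_toReal (measure_ne_top _ _)).mp hKμ.le
    refine h1.trans ?_
    rw [← integral_indicator_one hK.measurableSet]
    refine integral_mono ((integrable_const _).indicator hK.measurableSet) (hχint _) fun x => ?_
    by_cases hx : x ∈ K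
    · simp [hx, hχK hx]
    · simpa [hx] using (hχ x).1
  filter_upwards [Metric.tendsto_nhds.mp (hweak χ.continuous habs) ε hε,
    Metric.tendsto_nhds.mp (hweak hcont₀ (hb hC₀)) ε hε,
    Metric.tendstoUniformlyOn_iff.mp hunif ε hε] with i h1 h2 h3
  have h4 := htail (μ i) (hm i) (hC i)
  have h5 := htail μ₀ hm₀ hC₀
  have h6 : |∫ x, h i x * χ x ∂(μ i : Measure S) - ∫ x, h₀ x * χ x ∂(μ i : Measure S)| ≤ ε := by
    rw [← integral_sub (hint _ (hmul (hm i)) (hb (hC i)))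
      (hint _ (hmul hm₀) (hb hC₀)), ← Real.norm_eq_abs]
    refine (norm_integral_le_of_norm_le_const (C := ε)
      (Eventually.of_forall fun x => ?_)).trans (by simp)
    by_cases hx : x ∈ tsupport χ
    · have := h3 x hx
      rw [dist_comm, Real.dist_eq] at this
      rw [← sub_mul, norm_mul, Real.norm_eq_abs, Real.norm_eq_abs]
      exact (mul_le_mul this.le (habs x) (abs_nonneg _) hε.le).trans (mul_one ε).le
    · simp [image_eq_zero_of_notMem_tsupport hx, hε.le]
  rw [Real.dist_eq] at h1 h2 ⊢
  have h7 : C * (1 - ∫ x, χ x ∂(μ i : Measure S)) ≤ C * (2 * ε) :=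
    mul_le_mul_of_nonneg_left (by linarith [(abs_lt.mp h1).1]) hC0
  have h8 : C * (1 - ∫ x, χ x ∂(μ₀ : Measure S)) ≤ C * ε :=
    mul_le_mul_of_nonneg_left (by linarith) hC0
  have h4' := abs_le.mp (h4.trans h7)
  have h5' := abs_le.mp (h5.trans h8)
  have h6' := abs_le.mp h6
  have h2' := abs_lt.mp h2
  rw [abs_lt]
  constructor <;> linarith [h4'.1, h4'.2, h5'.1, h5'.2, h6'.1, h6'.2, h2'.1, h2'.2]

/-! ### Marginals and positivity of the limit -/

section Marginals

variable {μ : Measure (ℝ × ℝ)} [IsProbabilityMeasure μ]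

theorem tendsto_bivDistFun_fst (x : ℝ) :
    Tendsto (fun y => bivDistFun μ x y) atTop (𝓝 (cdf (μ.map Prod.fst) x)) := by
  have := Measure.isProbabilityMeasure_map (μ := μ) (f := Prod.fst) (by fun_prop)
  have h := tendsto_measure_iUnion_atTop (μ := μ) (s := fun y : ℝ => Iic x ×ˢ Iic y)
    fun a b hab => prod_mono le_rfl (Iic_subset_Iic.mpr hab)
  rw [← prod_iUnion, iUnion_Iic, prod_univ] at h
  rw [cdf_eq_real, map_measureReal_apply measurable_fst measurableSet_Iic]
  exact (ENNReal.tendsto_toReal (measure_ne_top _ _)).comp h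

theorem tendsto_bivDistFun_snd (y : ℝ) :
    Tendsto (fun x => bivDistFun μ x y) atTop (𝓝 (cdf (μ.map Prod.snd) y)) := by
  have := Measure.isProbabilityMeasure_map (μ := μ) (f := Prod.snd) (by fun_prop)
  have h := tendsto_measure_iUnion_atTop (μ := μ) (s := fun x : ℝ => Iic x ×ˢ Iic y)
    fun a b hab => prod_mono (Iic_subset_Iic.mpr hab) le_rfl
  rw [← iUnion_prod_const, iUnion_Iic, univ_prod] at h
  rw [cdf_eq_real, map_measureReal_apply measurable_snd measurableSet_Iic]
  exact (ENNReal.tendsto_toReal (measure_ne_top _ _)).comp h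

/-- Let `y → ∞` in the uniform estimate. The strict bound `ε / 2` becomes a weak one, which is still
below `ε`. -/
theorem InMDA.fst {F H : Measure (ℝ × ℝ)} [IsProbabilityMeasure F] [IsProbabilityMeasure H]
    {a₁ b₁ a₂ b₂ : ℝ → ℝ} (h : InMDA F H a₁ b₁ a₂ b₂) :
    TendstoUniformly (fun t x => cdf (F.map Prod.fst) (a₁ t * x + b₁ t) ^ t)
      (fun x => cdf (H.map Prod.fst) x) atTop := by
  refine Metric.tendstoUniformly_iff.mpr fun ε hε => ?_
  filter_upwards [Metric.tendstoUniformly_iff.mp h.2.2 (ε / 2) (by positivity), h.2.1,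
    eventually_ge_atTop 0] with t ht ha ht0 x
  have hy : Tendsto (fun y => a₂ t * y + b₂ t) atTop atTop :=
    tendsto_atTop_add_const_right _ _ (tendsto_id.const_mul_atTop ha)
  have h1 := ((tendsto_bivDistFun_fst (μ := F) (a₁ t * x + b₁ t)).comp hy).rpow_const
    (p := t) (Or.inr ht0)
  have h2 := (tendsto_bivDistFun_fst (μ := H) x).dist h1
  exact (le_of_tendsto' h2 fun y => (ht (x, y)).le).trans_lt (half_lt_self hε)

theorem InMDA.snd {F H : Measure (ℝ × ℝ)} [IsProbabilityMeasure F] [IsProbabilityMeasure H]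
    {a₁ b₁ a₂ b₂ : ℝ → ℝ} (h : InMDA F H a₁ b₁ a₂ b₂) :
    TendstoUniformly (fun t y => cdf (F.map Prod.snd) (a₂ t * y + b₂ t) ^ t)
      (fun y => cdf (H.map Prod.snd) y) atTop := by
  refine Metric.tendstoUniformly_iff.mpr fun ε hε => ?_
  filter_upwards [Metric.tendstoUniformly_iff.mp h.2.2 (ε / 2) (by positivity), h.1,
    eventually_ge_atTop 0] with t ht ha ht0 y
  have hx : Tendsto (fun x => a₁ t * x + b₁ t) atTop atTop :=
    tendsto_atTop_add_const_right _ _ (tendsto_id.const_mul_atTop ha)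
  have h1 := ((tendsto_bivDistFun_snd (μ := F) (a₂ t * y + b₂ t)).comp hx).rpow_const
    (p := t) (Or.inr ht0)
  have h2 := (tendsto_bivDistFun_snd (μ := H) y).dist h1
  exact (le_of_tendsto' h2 fun x => (ht (x, y)).le).trans_lt (half_lt_self hε)

theorem cdf_add_cdf_sub_one_le_bivDistFun (x y : ℝ) :
    cdf (μ.map Prod.fst) x + cdf (μ.map Prod.snd) y - 1 ≤ bivDistFun μ x y := by
  have := Measure.isProbabilityMeasure_map (μ := μ) (f := Prod.fst) (by fun_prop)
  have := Measure.isProbabilityMeasure_map (μ := μ) (f := Prod.snd) (by fun_prop)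
  rw [cdf_eq_real, cdf_eq_real, map_measureReal_apply measurable_fst measurableSet_Iic,
    map_measureReal_apply measurable_snd measurableSet_Iic]
  have h := measureReal_union_add_inter (μ := μ) (s := Prod.fst ⁻¹' Iic x)
    (measurable_snd (measurableSet_Iic (a := y)))
  have h1 : μ.real (Prod.fst ⁻¹' Iic x ∪ Prod.snd ⁻¹' Iic y) ≤ 1 := measureReal_le_one
  have h2 : bivDistFun μ x y = μ.real (Prod.fst ⁻¹' Iic x ∩ Prod.snd ⁻¹' Iic y) := rfl
  linarith

end Marginals

/-- If `p n ^ n` has a positive limit `h`, then `n * (1 - p n)` tends to `-log h`. -/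
theorem tendsto_nat_mul_one_sub_of_tendsto_pow {p : ℕ → ℝ} (h0 : ∀ n, 0 ≤ p n) {h : ℝ}
    (hh : 0 < h) (hp : Tendsto (fun n => p n ^ n) atTop (𝓝 h)) :
    Tendsto (fun n : ℕ => (n : ℝ) * (1 - p n)) atTop (𝓝 (-Real.log h)) := by
  have hpos : ∀ᶠ n : ℕ in atTop, 0 < p n := by
    filter_upwards [hp.eventually_const_lt hh, eventually_ne_atTop 0] with n hn hn0
    refine (h0 n).lt_of_ne fun h => ?_
    rw [← h, zero_pow hn0] at hn
    exact lt_irrefl _ hn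
  have hlog : Tendsto (fun n : ℕ => (n : ℝ) * Real.log (p n)) atTop (𝓝 (Real.log h)) :=
    (hp.log hh.ne').congr fun n => Real.log_pow (p n) n
  have hlog0 : Tendsto (fun n => Real.log (p n)) atTop (𝓝 0) := by
    have h1 := hlog.mul (tendsto_inv_atTop_nhds_zero_nat (𝕜 := ℝ))
    rw [mul_zero] at h1
    refine h1.congr' ?_
    filter_upwards [eventually_ne_atTop 0] with n hn
    field_simp
  have hp1 : Tendsto p atTop (𝓝 1) := by
    have h1 := (Real.continuous_exp.tendsto 0).comp hlog0
    rw [Real.exp_zero] at h1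
    refine h1.congr' ?_
    filter_upwards [hpos] with n hn
    exact Real.exp_log hn
  have hlow : Tendsto (fun n : ℕ => p n * -((n : ℝ) * Real.log (p n))) atTop
      (𝓝 (-Real.log h)) := by
    simpa using hp1.mul hlog.neg
  -- Squeeze by `-p * log p ≤ 1 - p ≤ -log p`.
  refine tendsto_of_tendsto_of_tendsto_of_le_of_le' hlow hlog.neg ?_ ?_
  · filter_upwards [hpos] with n hn
    have h1 := Real.one_sub_inv_le_log_of_pos hn
    have h2 : p n * (1 - (p n)⁻¹) ≤ p n * Real.log (p n) := mul_le_mul_of_nonneg_left h1 hn.le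
    rw [mul_sub, mul_inv_cancel₀ hn.ne', mul_one] at h2
    have h3 : (n : ℝ) * (p n - 1) ≤ n * (p n * Real.log (p n)) :=
      mul_le_mul_of_nonneg_left h2 n.cast_nonneg
    linarith
  · filter_upwards [hpos] with n hn
    have h3 : (n : ℝ) * Real.log (p n) ≤ n * (p n - 1) :=
      mul_le_mul_of_nonneg_left (Real.log_le_sub_one_of_pos hn) n.cast_nonneg
    linarith

/-- Write the power as `(p n ^ n)` raised to `⌊n / (k + 1)⌋ / n`, an exponent tending to `1 / (k +
1)`. -/
theorem tendsto_pow_nat_div_of_tendsto_pow {p : ℕ → ℝ} (h0 : ∀ n, 0 ≤ p n) {h : ℝ}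
    (hp : Tendsto (fun n => p n ^ n) atTop (𝓝 h)) (k : ℕ) :
    Tendsto (fun n => p n ^ (n / (k + 1))) atTop (𝓝 (h ^ (1 / ((k : ℝ) + 1)))) := by
  have hexp : Tendsto (fun n : ℕ => ((n / (k + 1) : ℕ) : ℝ) / n) atTop
      (𝓝 (1 / ((k : ℝ) + 1))) := by
    have h1 := (tendsto_nat_floor_mul_div_atTop (R := ℝ) (a := 1 / ((k : ℝ) + 1))
      (by positivity)).comp tendsto_natCast_atTop_atTop
    refine h1.congr fun n => ?_
    simp only [Function.comp_apply]
    rw [one_div_mul_eq_div, ← Nat.floor_div_eq_div (K := ℝ)]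
    push_cast
    rfl
  refine (hp.rpow hexp (Or.inr (by positivity))).congr' ?_
  filter_upwards [eventually_ne_atTop 0] with n hn
  rw [← Real.rpow_natCast, ← Real.rpow_mul (h0 n), mul_div_cancel₀ _ (Nat.cast_ne_zero.mpr hn),
    Real.rpow_natCast]

/-- The distribution function of a max-domain of attraction limit is positive where its marginals
are. -/
theorem InMDA.bivDistFun_pos {F H : Measure (ℝ × ℝ)} [IsProbabilityMeasure F]
    [IsProbabilityMeasure H] {a₁ b₁ a₂ b₂ : ℝ → ℝ} (h : InMDA F H a₁ b₁ a₂ b₂) {x y : ℝ}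
    (hx : 0 < cdf (H.map Prod.fst) x) (hy : 0 < cdf (H.map Prod.snd) y) :
    0 < bivDistFun H x y := by
  have hFn : Tendsto (fun n : ℕ => bivDistFun F (a₁ n * x + b₁ n) (a₂ n * y + b₂ n) ^ n) atTop
      (𝓝 (bivDistFun H x y)) :=
    ((h.2.2.tendsto_at (x, y)).comp tendsto_natCast_atTop_atTop).congr fun n =>
      Real.rpow_natCast _ n
  have h1 := tendsto_nat_mul_one_sub_of_tendsto_pow (fun n => cdf_nonneg _ _) hx
    (((h.fst.tendsto_at x).comp tendsto_natCast_atTop_atTop).congr fun n =>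
      Real.rpow_natCast _ n)
  have h2 := tendsto_nat_mul_one_sub_of_tendsto_pow (fun n => cdf_nonneg _ _) hy
    (((h.snd.tendsto_at y).comp tendsto_natCast_atTop_atTop).congr fun n =>
      Real.rpow_natCast _ n)
  -- The bound `F ≥ 1 - (1 - F₁) - (1 - F₂)`, raised to the power `n`, gives in the limit `H ≥ H₁ *
  -- H₂ > 0`.
  have h3 := (h1.add h2).neg
  have h4 := Real.tendsto_one_add_pow_exp_of_tendsto (h3.congr fun n => by
    rw [← mul_add, ← mul_neg])
  refine (Real.exp_pos _).trans_le (le_of_tendsto_of_tendsto h4 hFn ?_)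
  -- The lower bound must be nonnegative before powers are compared; both tails vanish, so it
  -- eventually is.
  have h5 : Tendsto (fun n : ℕ => ((n : ℝ))⁻¹ *
      (n * (1 - cdf (F.map Prod.fst) (a₁ n * x + b₁ n)) +
        n * (1 - cdf (F.map Prod.snd) (a₂ n * y + b₂ n)))) atTop (𝓝 0) := by
    simpa using (tendsto_inv_atTop_nhds_zero_nat (𝕜 := ℝ)).mul (h1.add h2)
  filter_upwards [h5.eventually_lt_const one_pos, eventually_ne_atTop 0] with n hn hn0
  rw [← mul_add, inv_mul_cancel_left₀ (Nat.cast_ne_zero.mpr hn0)] at hn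
  refine pow_le_pow_left₀ (by linarith) ?_ n
  have := cdf_add_cdf_sub_one_le_bivDistFun (μ := F) (a₁ n * x + b₁ n) (a₂ n * y + b₂ n)
  linarith

/-! ### Block bounds and tightness -/

/-- If at most `k` of the first `n` terms lie in `A`, then one of `k + 1` disjoint blocks of length
`n / (k + 1)` avoids `A`. -/
theorem exists_block_of_countUpTo_le {S : Type*} {A : Set S} {w : ℕ → S} {n k : ℕ}
    (h : countUpTo A w n ≤ k) :
    ∃ c ∈ Finset.range (k + 1),
      ∀ i ∈ Finset.Ico (c * (n / (k + 1))) ((c + 1) * (n / (k + 1))), w i ∈ Aᶜ := by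
  classical
  by_contra! hcon
  choose! f hf using hcon
  set q := n / (k + 1)
  have hcard : k + 1 ≤ countUpTo A w n := by
    rw [countUpTo]
    refine (Finset.card_range (k + 1)).symm.le.trans (Finset.card_le_card_of_injOn f ?_ ?_)
    · intro c hc
      obtain ⟨h1, h2⟩ := hf c hc
      have hc' : c + 1 ≤ k + 1 := Finset.mem_range.mp hc
      have h3 : (c + 1) * q ≤ (k + 1) * q := Nat.mul_le_mul_right _ hc'
      have h4 : (k + 1) * q ≤ n := Nat.mul_div_le n (k + 1)
      have h5 := (Finset.mem_Ico.mp h1).2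
      simp only [Finset.coe_filter, Finset.mem_range, Set.mem_ofPred_eq]
      exact ⟨by omega, not_not.mp h2⟩
    · intro c hc d hd hcd
      have h1 := Finset.mem_Ico.mp (hf c hc).1
      have h2 := Finset.mem_Ico.mp (hf d hd).1
      rw [hcd] at h1
      by_contra hne
      rcases lt_or_gt_of_ne hne with hlt | hlt
      · have : (c + 1) * q ≤ d * q := Nat.mul_le_mul_right _ hlt
        omega
      · have : (d + 1) * q ≤ c * q := Nat.mul_le_mul_right _ hlt
        omega
  omega

section IidCounts

variable {Ω S : Type*} [MeasurableSpace Ω] [MeasurableSpace S] {P : Measure Ω}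
  {F : Measure S} {W : ℕ → Ω → S}

theorem measureReal_forall_mem (hW : ∀ n, Measurable (W n)) (hindep : iIndepFun W P)
    (hlaw : ∀ n, P.map (W n) = F) {B : Set S} (hB : MeasurableSet B) (s : Finset ℕ) :
    P.real {ω | ∀ i ∈ s, W i ω ∈ B} = F.real B ^ s.card := by
  have h := hindep.measure_inter_preimage_eq_mul s (sets := fun _ => B) fun i _ => hB
  have h1 : {ω | ∀ i ∈ s, W i ω ∈ B} = ⋂ i ∈ s, W i ⁻¹' B := by
    ext ω
    simp
  rw [h1, Measure.real, h, ENNReal.toReal_prod]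
  refine Finset.prod_eq_pow_card fun i _ => ?_
  rw [← hlaw i, Measure.real, Measure.map_apply (hW i) hB]

theorem measureReal_countUpTo_eq_zero (hW : ∀ n, Measurable (W n)) (hindep : iIndepFun W P)
    (hlaw : ∀ n, P.map (W n) = F) {A : Set S} (hA : MeasurableSet A) (n : ℕ) :
    P.real {ω | countUpTo A (fun i => W i ω) n = 0} = F.real Aᶜ ^ n := by
  rw [← Finset.card_range n, ← measureReal_forall_mem hW hindep hlaw hA.compl (Finset.range n)]
  congr 1
  ext ω
  simp [countUpTo, Finset.filter_eq_empty_iff]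

/-- Union bound over the `k + 1` blocks, one of which must avoid `A`. The crude constant is
harmless: the bound serves only where the power becomes small. -/
theorem measureReal_countUpTo_le_le [IsProbabilityMeasure P] (hW : ∀ n, Measurable (W n))
    (hindep : iIndepFun W P) (hlaw : ∀ n, P.map (W n) = F) {A : Set S} (hA : MeasurableSet A)
    (n k : ℕ) :
    P.real {ω | countUpTo A (fun i => W i ω) n ≤ k}
      ≤ ((k : ℝ) + 1) * F.real Aᶜ ^ (n / (k + 1)) := by
  have hsub : {ω | countUpTo A (fun i => W i ω) n ≤ k} ⊆ ⋃ c ∈ Finset.range (k + 1),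
      {ω | ∀ i ∈ Finset.Ico (c * (n / (k + 1))) ((c + 1) * (n / (k + 1))), W i ω ∈ Aᶜ} := by
    intro ω hω
    obtain ⟨c, hc, h⟩ := exists_block_of_countUpTo_le hω
    exact mem_biUnion hc h
  refine (measureReal_mono hsub (measure_ne_top _ _)).trans ((measureReal_biUnion_finset_le _ _).trans ?_)
  simp_rw [measureReal_forall_mem hW hindep hlaw hA.compl, Nat.card_Ico, add_mul, one_mul,
    Nat.add_sub_cancel_left]
  rw [Finset.sum_const, Finset.card_range, nsmul_eq_mul]
  push_cast
  linarith

end IidCounts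

section Univariate

variable {Ω : Type*} [MeasurableSpace Ω] {P : Measure Ω} [IsProbabilityMeasure P]
  {G : Measure ℝ} [IsProbabilityMeasure G] {U : ℕ → Ω → ℝ}

theorem measureReal_countUpTo_Ioi_le_le (hU : ∀ n, Measurable (U n)) (hindep : iIndepFun U P)
    (hlaw : ∀ n, P.map (U n) = G) (u : ℝ) (n k : ℕ) :
    P.real {ω | countUpTo (Ioi u) (fun i => U i ω) n ≤ k}
      ≤ ((k : ℝ) + 1) * cdf G u ^ (n / (k + 1)) := by
  have h := measureReal_countUpTo_le_le hU hindep hlaw (measurableSet_Ioi (a := u)) n k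
  rwa [compl_Ioi, ← cdf_eq_real] at h

/-- A large positive value forces some term above the upper threshold; a large negative one leaves
at most `j` terms above the lower threshold, where the block bound applies. -/
theorem measureReal_lt_abs_orderStat_le (hU : ∀ n, Measurable (U n)) (hindep : iIndepFun U P)
    (hlaw : ∀ n, P.map (U n) = G) {a : ℝ} (ha : 0 < a) (b r : ℝ) {n j : ℕ} (hj : j < n) :
    P.real {ω | r < |(orderStat (fun i => U i ω) n (n - j) - b) / a|}
      ≤ (1 - cdf G (a * r + b) ^ n) + ((j : ℝ) + 1) * cdf G (a * -r + b) ^ (n / (j + 1)) := by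
  have hsub : {ω | r < |(orderStat (fun i => U i ω) n (n - j) - b) / a|}
      ⊆ {ω | countUpTo (Ioi (a * r + b)) (fun i => U i ω) n = 0}ᶜ ∪
        {ω | countUpTo (Ioi (a * -r + b)) (fun i => U i ω) n ≤ j} := by
    intro ω hω
    have hω' : r < |(orderStat (fun i => U i ω) n (n - j) - b) / a| := hω
    rcases lt_abs.mp hω' with h | h
    · refine Or.inl fun h0 => ?_
      have h0' : countUpTo (Ioi (a * r + b)) (fun i => U i ω) n = 0 := h0
      have h1 := (orderStat_le_iff (fun i => U i ω) hj (a * r + b)).mpr (by omega)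
      rw [lt_div_iff₀ ha] at h
      linarith
    · refine Or.inr ((orderStat_le_iff (fun i => U i ω) hj _).mp ?_)
      rw [← neg_div, lt_div_iff₀ ha] at h
      linarith
  have hm : MeasurableSet {ω | countUpTo (Ioi (a * r + b)) (fun i => U i ω) n = 0} :=
    ((measurable_countUpTo measurableSet_Ioi n).comp (measurable_pi_lambda _ hU))
      (measurableSet_singleton 0)
  refine (measureReal_mono hsub).trans ((measureReal_union_le _ _).trans ?_)
  refine add_le_add ?_ (measureReal_countUpTo_Ioi_le_le hU hindep hlaw _ n j)
  rw [probReal_compl_eq_one_sub hm, measureReal_countUpTo_eq_zero hU hindep hlaw measurableSet_Ioi,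
    compl_Ioi, ← cdf_eq_real]

end Univariate

theorem tendsto_tailBound (μ : Measure ℝ) (j : ℕ) :
    Tendsto (fun r : ℝ => (1 - cdf μ r) + ((j : ℝ) + 1) * cdf μ (-r) ^ (1 / ((j : ℝ) + 1)))
      atTop (𝓝 0) := by
  have h1 := (tendsto_cdf_atTop μ).const_sub 1
  have h2 := (((tendsto_cdf_atBot μ).comp tendsto_neg_atTop_atBot).rpow_const
    (p := 1 / ((j : ℝ) + 1)) (Or.inr (by positivity))).const_mul ((j : ℝ) + 1)
  have h3 := h1.add h2
  rwa [Real.zero_rpow (by positivity), mul_zero, sub_self, add_zero] at h3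

section Bivariate

variable {Ω : Type*} [MeasurableSpace Ω] {P : Measure Ω} [IsProbabilityMeasure P]
  {F H : Measure (ℝ × ℝ)} [IsProbabilityMeasure F] [IsProbabilityMeasure H]
  {a₁ b₁ a₂ b₂ : ℝ → ℝ} {X Y : ℕ → Ω → ℝ}

theorem measurable_normUpperStats_comp (hX : ∀ n, Measurable (X n)) (hY : ∀ n, Measurable (Y n))
    (m : ℕ) (s : ℝ) (n : ℕ) :
    Measurable fun ω => normUpperStats a₁ b₁ a₂ b₂ m s n (fun i => X i ω) (fun i => Y i ω) :=
  (measurable_normUpperStats a₁ b₁ a₂ b₂ m s).comp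
    (f := fun ω => ((fun i => (X i ω, Y i ω)), n))
    ((measurable_pi_lambda _ fun i => (hX i).prodMk (hY i)).prodMk measurable_const)

theorem tendsto_cdf_pow_of_uniform {μ ν : Measure ℝ} {a b : ℝ → ℝ}
    (h : TendstoUniformly (fun t x => cdf μ (a t * x + b t) ^ t) (fun x => cdf ν x) atTop)
    (x : ℝ) :
    Tendsto (fun n : ℕ => cdf μ (a n * x + b n) ^ n) atTop (𝓝 (cdf ν x)) :=
  ((h.tendsto_at x).comp tendsto_natCast_atTop_atTop).congr fun n => Real.rpow_natCast _ n

theorem isTightMeasureSet_normUpperStats (hX : ∀ n, Measurable (X n)) (hY : ∀ n, Measurable (Y n))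
    (hindep : iIndepFun (fun n ω => (X n ω, Y n ω)) P)
    (hlaw : ∀ n, P.map (fun ω => (X n ω, Y n ω)) = F) (hMDA : InMDA F H a₁ b₁ a₂ b₂) (m : ℕ) :
    IsTightMeasureSet (range fun n : ℕ => P.map fun ω =>
      normUpperStats a₁ b₁ a₂ b₂ m n n (fun i => X i ω) (fun i => Y i ω)) := by
  have hV := measurable_normUpperStats_comp (a₁ := a₁) (b₁ := b₁) (a₂ := a₂) (b₂ := b₂) hX hY m
  have hiX : iIndepFun X P := hindep.comp (fun _ => Prod.fst) fun _ => measurable_fst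
  have hiY : iIndepFun Y P := hindep.comp (fun _ => Prod.snd) fun _ => measurable_snd
  have hlX : ∀ n, P.map (X n) = F.map Prod.fst := fun n => by
    rw [← hlaw n, Measure.map_map measurable_fst ((hX n).prodMk (hY n))]
    rfl
  have hlY : ∀ n, P.map (Y n) = F.map Prod.snd := fun n => by
    rw [← hlaw n, Measure.map_map measurable_snd ((hX n).prodMk (hY n))]
    rfl
  have := Measure.isProbabilityMeasure_map (μ := F) (f := Prod.fst) (by fun_prop)
  have := Measure.isProbabilityMeasure_map (μ := F) (f := Prod.snd) (by fun_prop)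
  have : ∀ n : ℕ, IsProbabilityMeasure (P.map fun ω =>
      normUpperStats a₁ b₁ a₂ b₂ m n n (fun i => X i ω) (fun i => Y i ω)) := fun n =>
    Measure.isProbabilityMeasure_map (hV n n).aemeasurable
  refine isTightMeasureSet_range_of_tendsto_limsup_measure_norm_gt ?_
  -- `B r` is the limit as `n → ∞` of the union bound `β n` below, and it vanishes as `r → ∞`.
  let B : ℝ → ℝ := fun r => ∑ j : Fin m,
    (((1 - cdf (H.map Prod.fst) r) +
        ((j : ℝ) + 1) * cdf (H.map Prod.fst) (-r) ^ (1 / ((j : ℝ) + 1))) +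
      ((1 - cdf (H.map Prod.snd) r) +
        ((j : ℝ) + 1) * cdf (H.map Prod.snd) (-r) ^ (1 / ((j : ℝ) + 1))))
  have hB : Tendsto B atTop (𝓝 0) := by
    have h := tendsto_finsetSum (Finset.univ : Finset (Fin m)) fun j _ =>
      (tendsto_tailBound (H.map Prod.fst) j).add (tendsto_tailBound (H.map Prod.snd) j)
    simpa only [add_zero, Finset.sum_const_zero] using h
  have hB' := ENNReal.tendsto_ofReal hB
  rw [ENNReal.ofReal_zero] at hB'
  refine tendsto_of_tendsto_of_tendsto_of_le_of_le' tendsto_const_nhds hB'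
    (Eventually.of_forall fun _ => zero_le) ?_
  filter_upwards [eventually_ge_atTop 0] with r hr
  let β : ℕ → ℝ := fun n => ∑ j : Fin m,
    (((1 - cdf (F.map Prod.fst) (a₁ n * r + b₁ n) ^ n) +
        ((j : ℝ) + 1) * cdf (F.map Prod.fst) (a₁ n * -r + b₁ n) ^ (n / ((j : ℕ) + 1))) +
      ((1 - cdf (F.map Prod.snd) (a₂ n * r + b₂ n) ^ n) +
        ((j : ℝ) + 1) * cdf (F.map Prod.snd) (a₂ n * -r + b₂ n) ^ (n / ((j : ℕ) + 1))))
  have hβ : Tendsto β atTop (𝓝 (B r)) := by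
    refine tendsto_finsetSum _ fun j _ => ?_
    refine Tendsto.add (Tendsto.add ?_ ?_) (Tendsto.add ?_ ?_)
    · exact (tendsto_cdf_pow_of_uniform hMDA.fst r).const_sub 1
    · exact (tendsto_pow_nat_div_of_tendsto_pow (fun n => cdf_nonneg _ _)
        (tendsto_cdf_pow_of_uniform hMDA.fst (-r)) j).const_mul _
    · exact (tendsto_cdf_pow_of_uniform hMDA.snd r).const_sub 1
    · exact (tendsto_pow_nat_div_of_tendsto_pow (fun n => cdf_nonneg _ _)
        (tendsto_cdf_pow_of_uniform hMDA.snd (-r)) j).const_mul _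
  rw [← (ENNReal.tendsto_ofReal hβ).limsup_eq]
  refine limsup_le_limsup ?_
  -- For `n ≥ m` every index `n - j` with `j < m` lies in `{1, …, n}`, so the default value of
  -- `orderStat` does not occur.
  filter_upwards [eventually_ge_atTop m, tendsto_natCast_atTop_atTop.eventually hMDA.1,
    tendsto_natCast_atTop_atTop.eventually hMDA.2.1] with n hn h1 h2
  rw [ENNReal.le_ofReal_iff_toReal_le (measure_ne_top _ _) ?_]
  swap
  · refine Finset.sum_nonneg fun j _ => ?_
    have := pow_le_one₀ (n := n) (cdf_nonneg (F.map Prod.fst) (a₁ n * r + b₁ n)) (cdf_le_one _ _)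
    have := pow_le_one₀ (n := n) (cdf_nonneg (F.map Prod.snd) (a₂ n * r + b₂ n)) (cdf_le_one _ _)
    have := pow_nonneg (cdf_nonneg (F.map Prod.fst) (a₁ n * -r + b₁ n)) (n / ((j : ℕ) + 1))
    have := pow_nonneg (cdf_nonneg (F.map Prod.snd) (a₂ n * -r + b₂ n)) (n / ((j : ℕ) + 1))
    have := mul_nonneg (show (0 : ℝ) ≤ (j : ℝ) + 1 by positivity)
      (pow_nonneg (cdf_nonneg (F.map Prod.fst) (a₁ n * -r + b₁ n)) (n / ((j : ℕ) + 1)))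
    have := mul_nonneg (show (0 : ℝ) ≤ (j : ℝ) + 1 by positivity)
      (pow_nonneg (cdf_nonneg (F.map Prod.snd) (a₂ n * -r + b₂ n)) (n / ((j : ℕ) + 1)))
    linarith
  change (P.map _).real _ ≤ _
  rw [map_measureReal_apply (hV n n) (measurableSet_lt measurable_const measurable_norm)]
  have hsub : (fun ω => normUpperStats a₁ b₁ a₂ b₂ m n n (fun i => X i ω) (fun i => Y i ω)) ⁻¹'
      {x | r < ‖x‖} ⊆ ⋃ j ∈ (Finset.univ : Finset (Fin m)),
        ({ω | r < |(orderStat (fun i => X i ω) n (n - j) - b₁ n) / a₁ n|} ∪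
          {ω | r < |(orderStat (fun i => Y i ω) n (n - j) - b₂ n) / a₂ n|}) := by
    intro ω hω
    by_contra hcon
    simp only [mem_iUnion, mem_union, not_exists, not_or] at hcon
    refine absurd hω (not_lt.mpr ((pi_norm_le_iff_of_nonneg hr).mpr fun j => ?_))
    obtain ⟨h3, h4⟩ := hcon j (Finset.mem_univ j)
    exact max_le (not_lt.mp h3) (not_lt.mp h4)
  refine (measureReal_mono hsub (measure_ne_top _ _)).trans
    ((measureReal_biUnion_finset_le _ _).trans ?_)
  refine Finset.sum_le_sum fun j _ => (measureReal_union_le _ _).trans (add_le_add ?_ ?_)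
  · exact measureReal_lt_abs_orderStat_le hX hiX hlX h1 _ r (j.2.trans_le hn)
  · exact measureReal_lt_abs_orderStat_le hY hiY hlY h2 _ r (j.2.trans_le hn)

/-! ### Convergence of the joint distribution functions -/

theorem biUnion_preimage_Ioi_eq {S ι : Type*} {J : Finset ι} (g : S → ℝ) (v : ι → ℝ) {i₀ : ι}
    (hi₀ : i₀ ∈ J) (hmin : ∀ i ∈ J, v i₀ ≤ v i) {a : ℝ} (ha : 0 ≤ a) (b : ℝ) :
    ⋃ i ∈ J, g ⁻¹' Ioi (a * v i + b) = g ⁻¹' Ioi (a * v i₀ + b) := by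
  refine subset_antisymm (iUnion₂_subset fun i hi w hw => ?_) fun w hw => mem_biUnion hi₀ hw
  have h := mul_le_mul_of_nonneg_left (hmin i hi) ha
  have hw' : a * v i + b < g w := hw
  exact show a * v i₀ + b < g w by linarith

/-- The exceedance regions of finitely many thresholds, and their unions, are asymptotically rare
sets with convergent intensities. -/
theorem exists_tendsto_nat_mul_exceedance (hMDA : InMDA F H a₁ b₁ a₂ b₂) {m : ℕ}
    (v : Fin m → ℝ × ℝ) (h₁ : ∀ j, 0 < cdf (H.map Prod.fst) (v j).1)
    (h₂ : ∀ j, 0 < cdf (H.map Prod.snd) (v j).2) (J : Finset (Fin m ⊕ Fin m)) :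
    ∃ c, Tendsto (fun n : ℕ => (n : ℝ) * F.real (⋃ i ∈ J, Sum.elim
      (fun j => Prod.fst ⁻¹' Ioi (a₁ n * (v j).1 + b₁ n))
      (fun j => Prod.snd ⁻¹' Ioi (a₂ n * (v j).2 + b₂ n)) i)) atTop (𝓝 c) := by
  have := Measure.isProbabilityMeasure_map (μ := F) (f := Prod.fst) (by fun_prop)
  have := Measure.isProbabilityMeasure_map (μ := F) (f := Prod.snd) (by fun_prop)
  have hsplit : ∀ n : ℕ, ⋃ i ∈ J, Sum.elim
      (fun j => Prod.fst ⁻¹' Ioi (a₁ n * (v j).1 + b₁ n))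
      (fun j => Prod.snd ⁻¹' Ioi (a₂ n * (v j).2 + b₂ n)) i
      = (⋃ j ∈ J.toLeft, Prod.fst ⁻¹' Ioi (a₁ n * (v j).1 + b₁ n)) ∪
        ⋃ j ∈ J.toRight, Prod.snd ⁻¹' Ioi (a₂ n * (v j).2 + b₂ n) := by
    intro n
    ext w
    simp [Sum.exists]
  have hpos₁ : ∀ᶠ n : ℕ in atTop, 0 < a₁ n := tendsto_natCast_atTop_atTop.eventually hMDA.1
  have hpos₂ : ∀ᶠ n : ℕ in atTop, 0 < a₂ n := tendsto_natCast_atTop_atTop.eventually hMDA.2.1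
  simp_rw [hsplit]
  -- Nested half-planes collapse to the one with the smallest threshold. What remains is empty, one
  -- half-plane, or the complement of a quadrant.
  rcases J.toLeft.eq_empty_or_nonempty with hl | hl <;>
    rcases J.toRight.eq_empty_or_nonempty with hr | hr
  · exact ⟨0, by simp [hl, hr]⟩
  · obtain ⟨i, hi, hmin⟩ := Finset.exists_min_image _ (fun j => (v j).2) hr
    refine ⟨_, (tendsto_nat_mul_one_sub_of_tendsto_pow (fun n => cdf_nonneg _ _) (h₂ i)
      (tendsto_cdf_pow_of_uniform hMDA.snd _)).congr' ?_⟩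
    filter_upwards [hpos₂] with n hn
    rw [biUnion_preimage_Ioi_eq Prod.snd (fun j => (v j).2) hi hmin hn.le, hl, cdf_eq_real,
      map_measureReal_apply measurable_snd measurableSet_Iic,
      ← probReal_compl_eq_one_sub (measurable_snd measurableSet_Iic), ← preimage_compl, compl_Iic]
    simp
  · obtain ⟨i, hi, hmin⟩ := Finset.exists_min_image _ (fun j => (v j).1) hl
    refine ⟨_, (tendsto_nat_mul_one_sub_of_tendsto_pow (fun n => cdf_nonneg _ _) (h₁ i)
      (tendsto_cdf_pow_of_uniform hMDA.fst _)).congr' ?_⟩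
    filter_upwards [hpos₁] with n hn
    rw [biUnion_preimage_Ioi_eq Prod.fst (fun j => (v j).1) hi hmin hn.le, hr, cdf_eq_real,
      map_measureReal_apply measurable_fst measurableSet_Iic,
      ← probReal_compl_eq_one_sub (measurable_fst measurableSet_Iic), ← preimage_compl, compl_Iic]
    simp
  · obtain ⟨i, hi, hmini⟩ := Finset.exists_min_image _ (fun j => (v j).1) hl
    obtain ⟨k, hk, hmink⟩ := Finset.exists_min_image _ (fun j => (v j).2) hr
    refine ⟨_, (tendsto_nat_mul_one_sub_of_tendsto_pow (fun n => measureReal_nonneg)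
      (hMDA.bivDistFun_pos (h₁ i) (h₂ k)) (((hMDA.2.2.tendsto_at ((v i).1, (v k).2)).comp
      tendsto_natCast_atTop_atTop).congr fun n => Real.rpow_natCast _ n)).congr' ?_⟩
    filter_upwards [hpos₁, hpos₂] with n hn₁ hn₂
    rw [biUnion_preimage_Ioi_eq Prod.fst (fun j => (v j).1) hi hmini hn₁.le,
      biUnion_preimage_Ioi_eq Prod.snd (fun j => (v j).2) hk hmink hn₂.le,
      ← probReal_compl_eq_one_sub (measurableSet_Iic.prod measurableSet_Iic), compl_prod_eq_union,
      prod_univ, univ_prod, compl_Iic, compl_Iic]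

theorem exists_tendsto_cdf_normUpperStats (hX : ∀ n, Measurable (X n))
    (hY : ∀ n, Measurable (Y n)) (hindep : iIndepFun (fun n ω => (X n ω, Y n ω)) P)
    (hlaw : ∀ n, P.map (fun ω => (X n ω, Y n ω)) = F) (hMDA : InMDA F H a₁ b₁ a₂ b₂) (m : ℕ)
    (v : Fin m → ℝ × ℝ) :
    ∃ c, Tendsto (fun n : ℕ => P.real {ω |
      normUpperStats a₁ b₁ a₂ b₂ m n n (fun i => X i ω) (fun i => Y i ω) ≤ v}) atTop (𝓝 c) := by
  have hiX : iIndepFun X P := hindep.comp (fun _ => Prod.fst) fun _ => measurable_fst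
  have hiY : iIndepFun Y P := hindep.comp (fun _ => Prod.snd) fun _ => measurable_snd
  have hlX : ∀ n, P.map (X n) = F.map Prod.fst := fun n => by
    rw [← hlaw n, Measure.map_map measurable_fst ((hX n).prodMk (hY n))]
    rfl
  have hlY : ∀ n, P.map (Y n) = F.map Prod.snd := fun n => by
    rw [← hlaw n, Measure.map_map measurable_snd ((hX n).prodMk (hY n))]
    rfl
  have := Measure.isProbabilityMeasure_map (μ := F) (f := Prod.fst) (by fun_prop)
  have := Measure.isProbabilityMeasure_map (μ := F) (f := Prod.snd) (by fun_prop)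
  have hiff : ∀ᶠ n : ℕ in atTop, {ω |
      normUpperStats a₁ b₁ a₂ b₂ m n n (fun i => X i ω) (fun i => Y i ω) ≤ v}
      = {ω | ∀ j : Fin m,
        countUpTo (Ioi (a₁ n * (v j).1 + b₁ n)) (fun i => X i ω) n ≤ j ∧
        countUpTo (Ioi (a₂ n * (v j).2 + b₂ n)) (fun i => Y i ω) n ≤ j} := by
    filter_upwards [eventually_ge_atTop m, tendsto_natCast_atTop_atTop.eventually hMDA.1,
      tendsto_natCast_atTop_atTop.eventually hMDA.2.1] with n hn h1 h2
    ext ω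
    exact normUpperStats_le_iff hn h1 h2 _ _ v
  -- Where a marginal of `H` vanishes, `-log` gives no finite intensity; there the block bound
  -- forces the probability to `0`.
  by_cases h₁ : ∀ j, 0 < cdf (H.map Prod.fst) (v j).1
  swap
  · push Not at h₁
    obtain ⟨j, hj⟩ := h₁
    have hlim := (tendsto_pow_nat_div_of_tendsto_pow (fun n => cdf_nonneg _ _)
      (tendsto_cdf_pow_of_uniform hMDA.fst (v j).1) j).const_mul ((j : ℝ) + 1)
    rw [le_antisymm hj (cdf_nonneg _ _), Real.zero_rpow (by positivity), mul_zero] at hlim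
    refine ⟨0, tendsto_of_tendsto_of_tendsto_of_le_of_le' tendsto_const_nhds hlim
      (Eventually.of_forall fun n => measureReal_nonneg) ?_⟩
    filter_upwards [hiff] with n hn
    rw [hn]
    exact (measureReal_mono (fun ω hω => (hω j).1)).trans
      (measureReal_countUpTo_Ioi_le_le hX hiX hlX _ n j)
  by_cases h₂ : ∀ j, 0 < cdf (H.map Prod.snd) (v j).2
  swap
  · push Not at h₂
    obtain ⟨j, hj⟩ := h₂
    have hlim := (tendsto_pow_nat_div_of_tendsto_pow (fun n => cdf_nonneg _ _)
      (tendsto_cdf_pow_of_uniform hMDA.snd (v j).2) j).const_mul ((j : ℝ) + 1)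
    rw [le_antisymm hj (cdf_nonneg _ _), Real.zero_rpow (by positivity), mul_zero] at hlim
    refine ⟨0, tendsto_of_tendsto_of_tendsto_of_le_of_le' tendsto_const_nhds hlim
      (Eventually.of_forall fun n => measureReal_nonneg) ?_⟩
    filter_upwards [hiff] with n hn
    rw [hn]
    exact (measureReal_mono (fun ω hω => (hω j).2)).trans
      (measureReal_countUpTo_Ioi_le_le hY hiY hlY _ n j)
  obtain ⟨c, hc⟩ := exists_tendsto_measure_countUpTo_le
    (W := fun n ω => (X n ω, Y n ω)) (fun n => (hX n).prodMk (hY n)) hindep hlaw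
    (fun n : ℕ => Sum.elim (fun j : Fin m => Prod.fst ⁻¹' Ioi (a₁ n * (v j).1 + b₁ n))
      (fun j : Fin m => Prod.snd ⁻¹' Ioi (a₂ n * (v j).2 + b₂ n)))
    (fun n i => by
      rcases i with j | j
      · exact measurable_fst measurableSet_Ioi
      · exact measurable_snd measurableSet_Ioi)
    (fun J _ => exists_tendsto_nat_mul_exceedance hMDA v h₁ h₂ J)
    (Sum.elim (fun j => (j : ℕ)) fun j => (j : ℕ))
  refine ⟨c, hc.congr' ?_⟩
  filter_upwards [hiff] with n hn
  rw [hn]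
  congr 1
  ext ω
  simp only [Set.mem_ofPred_eq, Sum.forall, Sum.elim_inl, Sum.elim_inr, ← forall_and]
  rfl

end Bivariate

/-! ### The weak limit for deterministic sample size -/

section Limit

variable {Ω : Type*} [MeasurableSpace Ω] {P : Measure Ω} {F H : Measure (ℝ × ℝ)}
  {a₁ b₁ a₂ b₂ : ℝ → ℝ} {X Y : ℕ → Ω → ℝ}

/-- Both componentwise maxima lie below their thresholds iff all `n` pairs lie in one quadrant. This
is how `H` is recognized as the first marginal. -/
theorem measureReal_normUpperStats_zero_le (hX : ∀ n, Measurable (X n))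
    (hY : ∀ n, Measurable (Y n)) (hindep : iIndepFun (fun n ω => (X n ω, Y n ω)) P)
    (hlaw : ∀ n, P.map (fun ω => (X n ω, Y n ω)) = F) {m : ℕ} (hm : 0 < m) {s : ℝ} {n : ℕ}
    (hn : 0 < n) (h₁ : 0 < a₁ s) (h₂ : 0 < a₂ s) (p : ℝ × ℝ) :
    P.real {ω | normUpperStats a₁ b₁ a₂ b₂ m s n (fun i => X i ω) (fun i => Y i ω) ⟨0, hm⟩ ≤ p}
      = bivDistFun F (a₁ s * p.1 + b₁ s) (a₂ s * p.2 + b₂ s) ^ n := by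
  have h := measureReal_forall_mem (fun n => (hX n).prodMk (hY n)) hindep hlaw
    (B := Iic (a₁ s * p.1 + b₁ s) ×ˢ Iic (a₂ s * p.2 + b₂ s))
    (measurableSet_Iic.prod measurableSet_Iic) (Finset.range n)
  rw [Finset.card_range] at h
  rw [bivDistFun, ← h]
  congr 1
  ext ω
  have hX0 := orderStat_le_iff (fun i => X i ω) hn (a₁ s * p.1 + b₁ s)
  have hY0 := orderStat_le_iff (fun i => Y i ω) hn (a₂ s * p.2 + b₂ s)
  simp only [Set.mem_ofPred_eq, Prod.le_def, normUpperStats]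
  rw [div_le_iff₀ h₁, div_le_iff₀ h₂, sub_le_iff_le_add, sub_le_iff_le_add, mul_comm p.1,
    mul_comm p.2, hX0, hY0]
  simp only [countUpTo, nonpos_iff_eq_zero, Finset.card_eq_zero, Finset.filter_eq_empty_iff,
    mem_Ioi, not_lt, mem_prod, mem_Iic]
  exact forall₂_and.symm

/-- The joint law of the normalized upper order statistics converges weakly, and the limit law has
first marginal `H`. -/
theorem exists_tendsto_law_normUpperStats [IsProbabilityMeasure P] [IsProbabilityMeasure F]
    [IsProbabilityMeasure H] (hX : ∀ n, Measurable (X n))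
    (hY : ∀ n, Measurable (Y n)) (hindep : iIndepFun (fun n ω => (X n ω, Y n ω)) P)
    (hlaw : ∀ n, P.map (fun ω => (X n ω, Y n ω)) = F) (hMDA : InMDA F H a₁ b₁ a₂ b₂) {m : ℕ}
    (hm : 0 < m) (ρ : ℕ → ProbabilityMeasure (Fin m → ℝ × ℝ))
    (hρ : ∀ n : ℕ, (ρ n : Measure (Fin m → ℝ × ℝ)) = P.map fun ω =>
      normUpperStats a₁ b₁ a₂ b₂ m n n (fun i => X i ω) (fun i => Y i ω)) :
    ∃ ν : ProbabilityMeasure (Fin m → ℝ × ℝ), Tendsto ρ atTop (𝓝 ν) ∧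
      (ν : Measure (Fin m → ℝ × ℝ)).map (fun v => v ⟨0, hm⟩) = H := by
  have hV := measurable_normUpperStats_comp (a₁ := a₁) (b₁ := b₁) (a₂ := a₂) (b₂ := b₂) hX hY m
  choose c hc using exists_tendsto_cdf_normUpperStats hX hY hindep hlaw hMDA m
  obtain ⟨ν, hν⟩ := exists_tendsto_of_isTight_of_tendsto_cdf (cdfDetermining_pi (Fin m)) ρ
    (by simpa only [hρ] using isTightMeasureSet_normUpperStats hX hY hindep hlaw hMDA m) c
    (fun v => (hc v).congr fun n => by
      rw [hρ, map_measureReal_apply (hV n n) measurableSet_Iic]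
      rfl)
  refine ⟨ν, hν, ?_⟩
  have hcont : Continuous fun v : Fin m → ℝ × ℝ => v ⟨0, hm⟩ := continuous_apply _
  have hmap := ProbabilityMeasure.tendsto_map_of_tendsto_of_continuous ρ ν hν hcont
  have hreg := hasRegularizedCdf_of_tendsto (L := fun p => bivDistFun H p.1 p.2) hmap (fun p => by
    refine (((hMDA.2.2.tendsto_at p).comp tendsto_natCast_atTop_atTop).congr fun n =>
      Real.rpow_natCast _ n).congr' ?_
    filter_upwards [eventually_gt_atTop 0, tendsto_natCast_atTop_atTop.eventually hMDA.1,
      tendsto_natCast_atTop_atTop.eventually hMDA.2.1] with n hn h1 h2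
    rw [ProbabilityMeasure.toMeasure_map, map_measureReal_apply hcont.measurable measurableSet_Iic,
      hρ, map_measureReal_apply (hV n n) (hcont.measurable measurableSet_Iic),
      ← measureReal_normUpperStats_zero_le hX hY hindep hlaw hm hn h1 h2 p]
    rfl)
  rw [ProbabilityMeasure.toMeasure_map] at hreg
  have := Measure.isProbabilityMeasure_map (μ := (ν : Measure (Fin m → ℝ × ℝ)))
    hcont.measurable.aemeasurable
  refine hreg.unique cdfDetermining_prod (hasRegularizedCdf_of_eq fun p => ?_)
  rw [bivDistFun, Iic_prod_Iic]

end Limit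

/-! ### Change of norming and random sample size -/

/-- The coordinatewise affine map with parameters `((A₁, B₁), (A₂, B₂))`. -/
def affineRescale {m : ℕ} (θ : (ℝ × ℝ) × (ℝ × ℝ)) (v : Fin m → ℝ × ℝ) : Fin m → ℝ × ℝ :=
  fun j => (θ.1.1 * (v j).1 + θ.1.2, θ.2.1 * (v j).2 + θ.2.2)

theorem continuous_affineRescale (m : ℕ) :
    Continuous fun p : ((ℝ × ℝ) × (ℝ × ℝ)) × (Fin m → ℝ × ℝ) => affineRescale p.1 p.2 := by
  unfold affineRescale
  fun_prop

/-- Changing the norming constants acts on the order statistics by an affine map. -/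
theorem normUpperStats_eq_affineRescale {a₁ b₁ a₂ b₂ : ℝ → ℝ} {m : ℕ} {s t : ℝ} (n : ℕ)
    (h₁ : a₁ s ≠ 0) (h₂ : a₂ s ≠ 0) (x y : ℕ → ℝ) :
    normUpperStats a₁ b₁ a₂ b₂ m t n x y
      = affineRescale ((a₁ s / a₁ t, (b₁ s - b₁ t) / a₁ t), (a₂ s / a₂ t, (b₂ s - b₂ t) / a₂ t))
        (normUpperStats a₁ b₁ a₂ b₂ m s n x y) := by
  funext j
  -- Nothing is needed about `a t`: if it is `0`, both sides are `0` by the convention for division.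
  have key : ∀ {a b : ℝ → ℝ} (u : ℝ), a s ≠ 0 →
      (u - b t) / a t = a s / a t * ((u - b s) / a s) + (b s - b t) / a t := by
    intro a b u ha
    rw [div_mul_div_comm, mul_comm (a s), mul_div_mul_right _ _ ha, ← add_div]
    congr 1
    ring
  simp only [normUpperStats, affineRescale]
  rw [key _ h₁, key _ h₂]

/-- The affine parameters describing the effect of the time change with factor `z`. -/
noncomputable def timeChange (K₁ K₂ : ExtremeType) (z : ℝ) : (ℝ × ℝ) × (ℝ × ℝ) :=
  ((z ^ K₁.gamma, K₁.delta z), (z ^ K₂.gamma, K₂.delta z))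

theorem ExtremeType.measurable_delta (K : ExtremeType) : Measurable K.delta := by
  cases K
  · exact measurable_const
  · exact measurable_const
  · exact Real.measurable_log

theorem ExtremeType.continuousOn_delta (K : ExtremeType) : ContinuousOn K.delta (Ioi 0) := by
  cases K
  · exact continuousOn_const
  · exact continuousOn_const
  · exact Real.continuousOn_log.mono fun x hx => (mem_Ioi.mp hx).ne'

theorem measurable_timeChange (K₁ K₂ : ExtremeType) : Measurable (timeChange K₁ K₂) :=
  ((measurable_id.pow_const _).prodMk K₁.measurable_delta).prodMk
    ((measurable_id.pow_const _).prodMk K₂.measurable_delta)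

theorem continuousOn_timeChange (K₁ K₂ : ExtremeType) :
    ContinuousOn (timeChange K₁ K₂) (Ioi 0) := by
  have h : ∀ γ : ℝ, ContinuousOn (fun z : ℝ => z ^ γ) (Ioi 0) := fun γ =>
    continuousOn_id.rpow_const fun x hx => Or.inl (mem_Ioi.mp hx).ne'
  exact ((h _).prodMk K₁.continuousOn_delta).prodMk ((h _).prodMk K₂.continuousOn_delta)

theorem continuous_integral_affineRescale {m : ℕ} (ν : Measure (Fin m → ℝ × ℝ))
    [IsProbabilityMeasure ν] (f : BoundedContinuousFunction (Fin m → ℝ × ℝ) ℝ) :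
    Continuous fun θ => ∫ v, f (affineRescale θ v) ∂ν := by
  refine continuous_of_dominated (bound := fun _ => ‖f‖) (fun θ => ?_) (fun θ => ?_)
    (integrable_const _) ?_
  · exact (f.continuous.comp ((continuous_affineRescale m).comp
      (continuous_const.prodMk continuous_id))).measurable.aestronglyMeasurable
  · exact Eventually.of_forall fun v => f.norm_coe_le_norm _
  · exact Eventually.of_forall fun v => f.continuous.comp ((continuous_affineRescale m).comp
      (continuous_id.prodMk continuous_const))

section RandomIndex

variable {Ω : Type*} [MeasurableSpace Ω] {P : Measure Ω} {a₁ b₁ a₂ b₂ : ℝ → ℝ} {X Y : ℕ → Ω → ℝ}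

/-- If `n / t → z` then the upper order statistics of a sample of size `n`, normalized at `t`,
converge in distribution to an affine image of the limit law. -/
theorem tendsto_integral_normUpperStats_of_ratio (hX : ∀ n, Measurable (X n))
    (hY : ∀ n, Measurable (Y n)) {m : ℕ} {ρ : ℕ → ProbabilityMeasure (Fin m → ℝ × ℝ)}
    (hρ : ∀ n : ℕ, (ρ n : Measure (Fin m → ℝ × ℝ)) = P.map fun ω =>
      normUpperStats a₁ b₁ a₂ b₂ m n n (fun i => X i ω) (fun i => Y i ω))
    {ν : ProbabilityMeasure (Fin m → ℝ × ℝ)} (hν : Tendsto ρ atTop (𝓝 ν))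
    {ι : Type*} {l : Filter ι} {t : ι → ℝ} {n : ι → ℕ} (hn : Tendsto n l atTop)
    (h₁ : ∀ᶠ i in l, a₁ (n i) ≠ 0) (h₂ : ∀ᶠ i in l, a₂ (n i) ≠ 0) {θ : (ℝ × ℝ) × (ℝ × ℝ)}
    (hθ : Tendsto (fun i => ((a₁ (n i) / a₁ (t i), (b₁ (n i) - b₁ (t i)) / a₁ (t i)),
      (a₂ (n i) / a₂ (t i), (b₂ (n i) - b₂ (t i)) / a₂ (t i)))) l (𝓝 θ))
    (f : BoundedContinuousFunction (Fin m → ℝ × ℝ) ℝ) :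
    Tendsto (fun i => ∫ ω, f (normUpperStats a₁ b₁ a₂ b₂ m (t i) (n i) (fun k => X k ω)
      (fun k => Y k ω)) ∂P) l (𝓝 (∫ v, f (affineRescale θ v) ∂(ν : Measure (Fin m → ℝ × ℝ)))) := by
  have hc : ∀ θ, Continuous fun v : Fin m → ℝ × ℝ => f (affineRescale θ v) := fun θ =>
    f.continuous.comp ((continuous_affineRescale m).comp (continuous_const.prodMk continuous_id))
  have h := tendsto_integral_of_continuousConvergence (hν.comp hn) inferInstance isOpen_univ measure_univ
    (h := fun i v => f (affineRescale ((a₁ (n i) / a₁ (t i), (b₁ (n i) - b₁ (t i)) / a₁ (t i)),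
      (a₂ (n i) / a₂ (t i), (b₂ (n i) - b₂ (t i)) / a₂ (t i))) v))
    (h₀ := fun v => f (affineRescale θ v)) (C := ‖f‖) (fun i => (hc _).measurable)
    (hc θ).measurable (fun i v => f.norm_coe_le_norm _) (fun v => f.norm_coe_le_norm _)
    (hc θ).continuousOn (fun v _ => by
      have hcont : Continuous fun p : ((ℝ × ℝ) × (ℝ × ℝ)) × (Fin m → ℝ × ℝ) =>
        f (affineRescale p.1 p.2) := f.continuous.comp (continuous_affineRescale m)
      exact (hcont.tendsto (θ, v)).comp ((hθ.comp tendsto_fst).prodMk_nhds tendsto_snd))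
  refine h.congr' ?_
  filter_upwards [h₁, h₂] with i hi₁ hi₂
  rw [Function.comp_apply, hρ, integral_map
    (measurable_normUpperStats_comp hX hY m _ _).aemeasurable
    (hc _).measurable.aestronglyMeasurable]
  simp_rw [← normUpperStats_eq_affineRescale (n i) hi₁ hi₂]

/-- By independence the joint law of the claims and `N` is a product, and Fubini's theorem amounts
to conditioning on `N`. -/
theorem integral_normUpperStats_random_index [IsProbabilityMeasure P] (hX : ∀ n, Measurable (X n))
    (hY : ∀ n, Measurable (Y n)) {N : Ω → ℕ} (hN : Measurable N)
    (hindep : IndepFun (fun ω n => (X n ω, Y n ω)) N P) (m : ℕ) (s : ℝ)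
    (f : BoundedContinuousFunction (Fin m → ℝ × ℝ) ℝ) :
    ∫ ω, f (normUpperStats a₁ b₁ a₂ b₂ m s (N ω) (fun k => X k ω) (fun k => Y k ω)) ∂P
      = ∫ ω, ∫ ω', f (normUpperStats a₁ b₁ a₂ b₂ m s (N ω) (fun k => X k ω')
        (fun k => Y k ω')) ∂P ∂P := by
  have hW : Measurable fun ω n => (X n ω, Y n ω) :=
    measurable_pi_lambda _ fun i => (hX i).prodMk (hY i)
  have := Measure.isProbabilityMeasure_map (μ := P) hW.aemeasurable
  have := Measure.isProbabilityMeasure_map (μ := P) hN.aemeasurable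
  have hφ : Measurable fun p : (ℕ → ℝ × ℝ) × ℕ => f (normUpperStats a₁ b₁ a₂ b₂ m s p.2
      (fun i => (p.1 i).1) (fun i => (p.1 i).2)) :=
    f.continuous.measurable.comp (measurable_normUpperStats a₁ b₁ a₂ b₂ m s)
  have h1 := integral_map (μ := P) (hW.prodMk hN).aemeasurable hφ.aestronglyMeasurable
  rw [(indepFun_iff_map_prod_eq_prod_map_map hW.aemeasurable hN.aemeasurable).mp hindep,
    integral_prod_symm _ (Integrable.of_bound hφ.aestronglyMeasurable ‖f‖
      (Eventually.of_forall fun p => f.norm_coe_le_norm _)),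
    integral_map hN.aemeasurable (measurable_of_countable _).aestronglyMeasurable] at h1
  rw [← h1]
  refine integral_congr_ae (Eventually.of_forall fun ω => ?_)
  exact integral_map hW.aemeasurable (hφ.comp measurable_prodMk_right).aestronglyMeasurable

end RandomIndex

/-- The index `⌊r * t⌋` extends functions of `n / t` to all real ratios `r`; the joint limit in `(t,
r)` supplies continuous convergence. -/
theorem tendsto_floor_mul_ratio {z : ℝ} (hz : 0 < z) :
    Tendsto (fun p : ℝ≥0 × ℝ => ⌊p.2 * p.1⌋₊) (atTop ×ˢ 𝓝 z) atTop ∧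
      Tendsto (fun p : ℝ≥0 × ℝ => (⌊p.2 * p.1⌋₊ : ℝ) / p.1) (atTop ×ˢ 𝓝 z) (𝓝 z) := by
  have ht : Tendsto (fun p : ℝ≥0 × ℝ => (p.1 : ℝ)) (atTop ×ˢ 𝓝 z) atTop :=
    NNReal.tendsto_coe_atTop.mpr tendsto_fst
  have hp : Tendsto (fun p : ℝ≥0 × ℝ => p.2 * p.1) (atTop ×ˢ 𝓝 z) atTop :=
    Tendsto.pos_mul_atTop hz tendsto_snd ht
  refine ⟨tendsto_nat_floor_atTop.comp hp, ?_⟩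
  have h1 := ((tendsto_nat_floor_div_atTop (R := ℝ)).comp hp).mul
    (tendsto_snd (f := (atTop : Filter ℝ≥0)) (g := 𝓝 z))
  rw [one_mul] at h1
  refine h1.congr' ?_
  filter_upwards [hp.eventually_ne_atTop 0, ht.eventually_ne_atTop 0] with p hp0 ht0
  simp only [Function.comp_apply]
  have hp2 : p.2 ≠ 0 := left_ne_zero_of_mul hp0
  field_simp

/-! ### The main theorem -/

theorem corollary2p2
    {Ω Ω' : Type*} [MeasurableSpace Ω] [MeasurableSpace Ω']
    (P : Measure Ω) [IsProbabilityMeasure P] (P' : Measure Ω') [IsProbabilityMeasure P']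
    (F H : Measure (ℝ × ℝ)) [IsProbabilityMeasure F] [IsProbabilityMeasure H]
    (a₁ b₁ a₂ b₂ : ℝ → ℝ)
    -- the claims and the claim counts (`X 0, Y 0` is the first claim)
    (X Y : ℕ → Ω → ℝ) (N : ℝ≥0 → Ω → ℕ)
    (hX : ∀ n, Measurable (X n)) (hY : ∀ n, Measurable (Y n)) (hN : ∀ t, Measurable (N t))
    -- the claims are iid with distribution function `F`
    (hindep : iIndepFun (fun n ω => (X n ω, Y n ω)) P)
    (hlaw : ∀ n, P.map (fun ω => (X n ω, Y n ω)) = F)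
    -- the claim sequence is independent of `N t`
    (hXYN : ∀ t, IndepFun (fun ω n => (X n ω, Y n ω)) (N t) P)
    -- the marginals of `H` are standard extreme value distributions, and `F ∈ MDA(H)`
    (K₁ K₂ : ExtremeType)
    (hH₁ : ∀ x, cdf (H.map Prod.fst) x = K₁.distFun x)
    (hH₂ : ∀ y, cdf (H.map Prod.snd) y = K₂.distFun y)
    (hMDA : InMDA F H a₁ b₁ a₂ b₂)
    -- `N t / t` converges in distribution to the almost surely positive `Z`
    (Z : Ω' → ℝ) (hZ : ∀ᵐ ω ∂P', 0 < Z ω)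
    (hNZ : TendstoInDistribution (fun (t : ℝ≥0) ω => (N t ω : ℝ) / (t : ℝ)) atTop Z
      (fun _ => P) P')
    (m : ℕ) (hm : 1 ≤ m) :
    -- `ν` is the law of `((𝒳₁, 𝒴₁), …, (𝒳ₘ, 𝒴ₘ))`
    ∃ (ν : Measure (Fin m → ℝ × ℝ)) (_ : IsProbabilityMeasure ν),
      ν.map (fun v => v ⟨0, hm⟩) = H ∧
      TendstoInDistribution
        (fun (n : ℕ) ω =>
          normUpperStats a₁ b₁ a₂ b₂ m n n (fun i => X i ω) (fun i => Y i ω))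
        atTop id (fun _ => P) ν ∧
      -- on the product space `Z` is independent of the vector `v` with law `ν`
      TendstoInDistribution
        (fun (t : ℝ≥0) ω =>
          normUpperStats a₁ b₁ a₂ b₂ m t (N t ω) (fun i => X i ω) (fun i => Y i ω))
        atTop
        (fun (q : Ω' × (Fin m → ℝ × ℝ)) (j : Fin m) =>
          (Z q.1 ^ K₁.gamma * (q.2 j).1 + K₁.delta (Z q.1),
           Z q.1 ^ K₂.gamma * (q.2 j).2 + K₂.delta (Z q.1)))
        (fun _ => P) (P'.prod ν) := by
  have hV := measurable_normUpperStats_comp (a₁ := a₁) (b₁ := b₁) (a₂ := a₂) (b₂ := b₂) hX hY m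
  let ρ : ℕ → ProbabilityMeasure (Fin m → ℝ × ℝ) := fun n =>
    ⟨P.map fun ω => normUpperStats a₁ b₁ a₂ b₂ m n n (fun i => X i ω) (fun i => Y i ω),
      Measure.isProbabilityMeasure_map (hV n n).aemeasurable⟩
  obtain ⟨ν, hν, hνH⟩ := exists_tendsto_law_normUpperStats hX hY hindep hlaw hMDA hm ρ
    fun n => rfl
  have hcdf₁ : ⇑(cdf (H.map Prod.fst)) = K₁.distFun := funext hH₁
  have hcdf₂ : ⇑(cdf (H.map Prod.snd)) = K₂.distFun := funext hH₂
  have hK₁ : Monotone K₁.distFun := hcdf₁ ▸ monotone_cdf _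
  have hK₂ : Monotone K₂.distFun := hcdf₂ ▸ monotone_cdf _
  have hU₁ := hMDA.fst
  have hU₂ := hMDA.snd
  simp only [hH₁] at hU₁
  simp only [hH₂] at hU₂
  have hVN : ∀ t : ℝ≥0, Measurable fun ω =>
      normUpperStats a₁ b₁ a₂ b₂ m t (N t ω) (fun i => X i ω) (fun i => Y i ω) := fun t =>
    (measurable_normUpperStats a₁ b₁ a₂ b₂ m t).comp
      (f := fun ω => ((fun i => (X i ω, Y i ω)), N t ω))
      ((measurable_pi_lambda _ fun i => (hX i).prodMk (hY i)).prodMk (hN t))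
  have hlimit : AEMeasurable (fun (q : Ω' × (Fin m → ℝ × ℝ)) (j : Fin m) =>
      (Z q.1 ^ K₁.gamma * (q.2 j).1 + K₁.delta (Z q.1),
        Z q.1 ^ K₂.gamma * (q.2 j).2 + K₂.delta (Z q.1))) (P'.prod ν) :=
    (continuous_affineRescale m).measurable.comp_aemeasurable
      (((measurable_timeChange K₁ K₂).comp_aemeasurable
        hNZ.aemeasurable_limit.comp_fst).prodMk measurable_snd.aemeasurable)
  refine ⟨ν, inferInstance, hνH, ⟨fun n => (hV n n).aemeasurable, aemeasurable_id, ?_⟩,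
    ⟨fun t => (hVN t).aemeasurable, hlimit, ?_⟩⟩
  · have hid : (⟨(ν : Measure (Fin m → ℝ × ℝ)).map id,
        Measure.isProbabilityMeasure_map aemeasurable_id⟩ :
        ProbabilityMeasure (Fin m → ℝ × ℝ)) = ν := Subtype.ext Measure.map_id
    exact hν.mono_right (congrArg (𝓝 : ProbabilityMeasure (Fin m → ℝ × ℝ) → _) hid.symm).le
  refine ProbabilityMeasure.tendsto_iff_forall_integral_tendsto.mpr fun f => ?_
  simp only [ProbabilityMeasure.coe_mk]
  have hint : Integrable (fun q : Ω' × (Fin m → ℝ × ℝ) =>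
      f (affineRescale (timeChange K₁ K₂ (Z q.1)) q.2)) (P'.prod ν) :=
    Integrable.of_bound (f.continuous.measurable.comp_aemeasurable hlimit).aestronglyMeasurable
      ‖f‖ (Eventually.of_forall fun q => f.norm_coe_le_norm _)
  rw [integral_map hlimit f.continuous.measurable.aestronglyMeasurable]
  refine Tendsto.mono_right ?_ (congrArg 𝓝 (integral_prod _ hint).symm).le
  have hg : Continuous fun θ => ∫ v, f (affineRescale θ v) ∂(ν : Measure (Fin m → ℝ × ℝ)) :=
    continuous_integral_affineRescale _ f
  have hgb : ∀ θ, |∫ v, f (affineRescale θ v) ∂(ν : Measure (Fin m → ℝ × ℝ))| ≤ ‖f‖ := fun θ =>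
    (norm_integral_le_of_norm_le_const (Eventually.of_forall fun v =>
      f.norm_coe_le_norm _)).trans (by simp)
  have hpos : (P'.map Z) (Ioi 0) = 1 := by
    have := Measure.isProbabilityMeasure_map hNZ.aemeasurable_limit
    refine (prob_compl_eq_zero_iff measurableSet_Ioi).mp ?_
    rw [Measure.map_apply_of_aemeasurable hNZ.aemeasurable_limit measurableSet_Ioi.compl]
    exact measure_eq_zero_iff_ae_notMem.mpr (hZ.mono fun ω hω h => h hω)
  have hgm : Measurable fun z =>
      ∫ v, f (affineRescale (timeChange K₁ K₂ z) v) ∂(ν : Measure (Fin m → ℝ × ℝ)) :=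
    hg.measurable.comp (measurable_timeChange K₁ K₂)
  have hhm : ∀ t : ℝ≥0, Measurable fun r : ℝ => ∫ ω, f (normUpperStats a₁ b₁ a₂ b₂ m t ⌊r * t⌋₊
      (fun k => X k ω) (fun k => Y k ω)) ∂P := fun t =>
    (measurable_of_countable fun n : ℕ => ∫ ω, f (normUpperStats a₁ b₁ a₂ b₂ m t n
      (fun k => X k ω) (fun k => Y k ω)) ∂P).comp
        (Nat.measurable_floor.comp (measurable_id.mul_const _))
  have hZprob := Measure.isProbabilityMeasure_map hNZ.aemeasurable_limit
  have hreg : (P'.map Z).Regular := inferInstance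
  -- At `r = N(t) / t` the function `h t` is the conditional expectation given `N(t)`. Its
  -- continuous convergence is needed only at `z > 0`, where the norming ratios converge.
  have hmain := tendsto_integral_of_continuousConvergence hNZ.tendsto hreg isOpen_Ioi hpos
    (h := fun (t : ℝ≥0) (r : ℝ) => ∫ ω, f (normUpperStats a₁ b₁ a₂ b₂ m t ⌊r * t⌋₊
      (fun k => X k ω) (fun k => Y k ω)) ∂P)
    (h₀ := fun z => ∫ v, f (affineRescale (timeChange K₁ K₂ z) v) ∂(ν : Measure (Fin m → ℝ × ℝ))) (C := ‖f‖)
    hhm hgm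
    (fun t r => (norm_integral_le_of_norm_le_const (Eventually.of_forall fun v =>
      f.norm_coe_le_norm _)).trans (by simp))
    (fun z => hgb _) (hg.comp_continuousOn (continuousOn_timeChange K₁ K₂))
    (fun z hz => by
      obtain ⟨hn, hr⟩ := tendsto_floor_mul_ratio hz
      have hs : Tendsto (fun p : ℝ≥0 × ℝ => (⌊p.2 * p.1⌋₊ : ℝ)) (atTop ×ˢ 𝓝 z) atTop :=
        tendsto_natCast_atTop_atTop.comp hn
      have ht : Tendsto (fun p : ℝ≥0 × ℝ => (p.1 : ℝ)) (atTop ×ˢ 𝓝 z) atTop :=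
        NNReal.tendsto_coe_atTop.mpr tendsto_fst
      obtain ⟨hA₁, hB₁⟩ := tendsto_norming_ratio hK₁ (cdf_nonneg (F.map Prod.fst)) hMDA.1 hU₁ hs ht
        hz hr
      obtain ⟨hA₂, hB₂⟩ := tendsto_norming_ratio hK₂ (cdf_nonneg (F.map Prod.snd)) hMDA.2.1 hU₂ hs ht
        hz hr
      exact tendsto_integral_normUpperStats_of_ratio hX hY (fun n => rfl) hν hn
        ((hs.eventually hMDA.1).mono fun p hp => hp.ne')
        ((hs.eventually hMDA.2.1).mono fun p hp => hp.ne')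
        ((hA₁.prodMk_nhds hB₁).prodMk_nhds (hA₂.prodMk_nhds hB₂)) f)
  simp only [ProbabilityMeasure.coe_mk] at hmain
  rw [integral_map hNZ.aemeasurable_limit hgm.aestronglyMeasurable] at hmain
  refine hmain.congr' ?_
  -- For `t > 0` the floor of `(N t / t) * t` returns `N t` exactly.
  filter_upwards [eventually_gt_atTop 0] with t ht
  have ht' : (t : ℝ) ≠ 0 := (NNReal.coe_pos.mpr ht).ne'
  rw [integral_map (hVN t).aemeasurable f.continuous.measurable.aestronglyMeasurable,
    integral_normUpperStats_random_index hX hY (hN t) (hXYN t) m t f,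
    integral_map (hNZ.forall_aemeasurable t)
      (hhm t).aestronglyMeasurable]
  simp_rw [div_mul_cancel₀ _ ht', Nat.floor_natCast]
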